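/- Let $0<\alpha<1$, $\tau>0$, let $\mathbb K$ be $\mathbb R$ or $\mathbb C$, let $\lambda,y_0\in\mathbb K$, let $f:[0,\infty)\to\mathbb K$ be continuous and let $\phi(t)=(t/\tau+1)y_0$ for $t\in[-\tau,0]$. For a function $y$ on $[-\tau,\infty)$ let $y_\phi$ be the function on $\mathbb R$ with $y_\phi(t)=\phi(-\tau)$ for $t<-\tau$, $y_\phi(t)=\phi(t)$ for $-\tau\le t\le 0$ and $y_\phi(t)=y(t)$ for $t>0$, and let $$ {}^{\phi_\tau}\!D_0^\alpha y(t)=\lim_{h\to0^+}\frac1{h^\alpha}\sum_{j=0}^\infty\omega_j^{(\alpha)}\,y_\phi(t-jh),\qquad \omega_j^{(\alpha)}=\frac{(-1)^j\,\Gamma(\alpha+1)}{j!\,\Gamma(\alpha-j+1)} ,$$ be its modified (Grünwald--Letnikov) fractional derivative. A solution of the delay equation $$ {}^{\phi_\tau}\!D_0^\alpha \hat y(t)=\lambda\,\hat y(t-\tau)+f(t)\quad(t>0),\qquad \hat y(t)=\phi(t)\quad(-\tau\le t\le0) \tag{$*$}$$ is a continuous function $\hat y:[-\tau,\infty)\to\mathbb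 K$ for which the derivative exists at every $t>0$ and $(*)$ holds. Then $(*)$ has a solution, it is unique, and for every integer $p\ge0$ and every $t\in[p\tau,(p+1)\tau)$ it is given by $$\hat y(t)=\frac{y_0}{\tau}\left[\lambda^{p+1}\frac{(t-p\tau)^{\alpha(p+1)+1}}{\Gamma(\alpha(p+1)+2)}+\sum_{k=0}^{p}\lambda^k\frac{(t+\tau-k\tau)^{\alpha k+1}}{\Gamma(\alpha k+2)}\,I_{\frac{\tau}{t+\tau-k\tau}}\bigl(2-\alpha,(k+1)\alpha\bigr)\right]+\mathcal J_{0,\tau,\lambda}f(t),$$ where $I_x(a,b)=\frac1{B(a,b)}\int_0^x r^{a-1}(1-r)^{b-1}\,dr$ is the regularized incomplete beta function, $B$ is the beta function, and $$\mathcal J_{0,\tau,\lambda}f(t)=\sum_{k=0}^{\lfloor t/\tau\rfloor}\frac{\lambda^k}{\Gamma(\alpha k+\alpha)}\int_0^{t-k\tau}(t-k\tau-r)^{\alpha k+\alpha-1}f(r)\,dr .$$ -/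

import Mathlib

open Set Filter Topology

/-- The Grünwald–Letnikov weight
`ω_j^{(α)} = (-1)^j Γ(α + 1) / (j! Γ(α - j + 1))`. -/
noncomputable def glWeight (α : ℝ) (j : ℕ) : ℝ :=
  (-1) ^ j * Real.Gamma (α + 1) / ((j.factorial : ℝ) * Real.Gamma (α - j + 1))

/-- The Grünwald–Letnikov derivative of order `α` of `y : ℝ → 𝕜` at `t` exists and equals `d`:
for all small `h > 0` the series `∑_{j ≥ 0} ω_j^{(α)} y(t - j h)` converges, and
`h^{-α} ∑_{j ≥ 0} ω_j^{(α)} y(t - j h)` tends to `d` as `h → 0+`. -/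
def HasGLDerivAt {𝕜 : Type*} [RCLike 𝕜] (α : ℝ) (y : ℝ → 𝕜) (d : 𝕜) (t : ℝ) : Prop :=
  (∀ᶠ h : ℝ in 𝓝[>] 0, Summable fun j : ℕ => glWeight α j • y (t - j * h)) ∧
  Tendsto (fun h : ℝ => (1 / h ^ α) • ∑' j : ℕ, glWeight α j • y (t - j * h)) (𝓝[>] 0) (𝓝 d)

/-- The extension `φ_τ` of an initial function `φ` on `[-τ, 0]` to the left of `-τ`, by the
constant `φ(-τ)`. -/
noncomputable def historyExt {𝕜 : Type*} (τ : ℝ) (φ : ℝ → 𝕜) (t : ℝ) : 𝕜 :=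
  if t < -τ then φ (-τ) else φ t

/-- The function equal to `φ_τ` on `(-∞, 0]` and to `y` on `(0, ∞)`. -/
noncomputable def glueHistory {𝕜 : Type*} (τ : ℝ) (φ y : ℝ → 𝕜) (t : ℝ) : 𝕜 :=
  if t ≤ 0 then historyExt τ φ t else y t

/-- The modified fractional derivative of `y` of order `α` at `t` exists and equals `d`: it is the
Grünwald–Letnikov derivative of the function obtained from `y` by inserting the history `φ_τ` on
`(-∞, 0]`. -/
def HasModifiedDerivAt {𝕜 : Type*} [RCLike 𝕜] (α τ : ℝ) (φ y : ℝ → 𝕜) (d : 𝕜) (t : ℝ) : Prop :=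
  HasGLDerivAt α (glueHistory τ φ y) d t

/-- `y` is a (continuous, global) solution of the linear fractional delay differential equation
with the modified operator: `D y(t) = l * y(t - τ) + f(t)` for `t > 0` and `y = φ` on `[-τ, 0]`.
Only the values of `y` on `[-τ, ∞)`, of `φ` on `[-τ, 0]` and of `f` on `(0, ∞)` matter. -/
structure IsModifiedFDDESolution {𝕜 : Type*} [RCLike 𝕜] (α τ : ℝ) (l : 𝕜) (φ f y : ℝ → 𝕜) :
    Prop where
  continuousOn : ContinuousOn y (Ici (-τ))
  history : ∀ t ∈ Icc (-τ) 0, y t = φ t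
  equation : ∀ t : ℝ, 0 < t → HasModifiedDerivAt α τ φ y (l * y (t - τ) + f t) t

/-- The (regularized) incomplete beta function
`I_x(a, b) = B(a, b)⁻¹ ∫_0^x r^{a-1} (1 - r)^{b-1} dr`. -/
noncomputable def incompleteBeta (x a b : ℝ) : ℝ :=
  1 / ProbabilityTheory.beta a b * ∫ r in (0 : ℝ)..x, r ^ (a - 1) * (1 - r) ^ (b - 1)

/-- The generalized integral
`∑_{k=0}^{⌊t/τ⌋} l^k / Γ(α k + α) ∫_0^{t-kτ} (t - k τ - r)^{α k + α - 1} f(r) dr`. -/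
noncomputable def generalizedIntegral {𝕜 : Type*} [RCLike 𝕜] (α τ : ℝ) (l : 𝕜) (f : ℝ → 𝕜)
    (t : ℝ) : 𝕜 :=
  ∑ k ∈ Finset.range (⌊t / τ⌋₊ + 1),
    l ^ k / ((Real.Gamma (α * k + α) : ℝ) : 𝕜) *
      ∫ r in (0 : ℝ)..(t - k * τ), ((t - k * τ - r) ^ (α * k + α - 1) : ℝ) • f r

/-! Since `φ` vanishes at `-τ`, the glued function vanishes to the left of `-τ`. On such functions
the Grünwald–Letnikov derivative inverts the Riemann–Liouville integral `I^α` with lower limit `-∞`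
at points of continuity (`hasGLDerivAt_rlIntegral`). To prove this, rescale by `h` and split
`x^(α-1)` into a step function with values `Γ(m+α)/m!` plus a defect. The weights are the
convolution inverse of the steps, up to `Γ(α)`, so the step part collapses to an average of the
integrand over `[t-h, t]`. The defect is integrable, and its contribution tends to a multiple of `∑
ω_j = 0`.

Existence: it therefore suffices to solve `y = I^α (F + l y(· - τ))`, where `F` is the derivative of
the affine history on `(-τ, 0)` and `f` afterwards. Picard iteration and the semigroup law give `∑
l^k (I^(α(k+1)) F)(t - kτ)`, a finite sum by causality. A complete beta integral recovers the
history for `t ≤ 0`; the cut-off of the history at `0` produces the incomplete beta functions for `t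
> 0`.

Uniqueness (`IsModifiedFDDESolution.eqOn`): by the method of steps, the difference of two solutions
has zero derivative on one more interval of length `τ`. All weights after the first are negative
with total `-1`, which yields a maximum principle forcing that difference to vanish. -/

/-! ### Grünwald–Letnikov weights -/

/-- The coefficient `Γ(m + β) / m!`, i.e. `Γ(β)` times the coefficient of `z ^ m` in
`(1 - z) ^ (-β)`. -/
noncomputable def risingCoeff (β : ℝ) (m : ℕ) : ℝ :=
  Real.Gamma (m + β) / (m.factorial : ℝ)

lemma risingCoeff_zero (β : ℝ) : risingCoeff β 0 = Real.Gamma β := by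
  simp [risingCoeff]

lemma risingCoeff_pos {β : ℝ} (hβ : 0 < β) (m : ℕ) : 0 < risingCoeff β m := by
  unfold risingCoeff
  have := Real.Gamma_pos_of_pos (show 0 < (m : ℝ) + β by positivity)
  positivity

lemma risingCoeff_succ {β : ℝ} (hβ : 0 < β) (m : ℕ) :
    ((m : ℝ) + 1) * risingCoeff β (m + 1) = (m + β) * risingCoeff β m := by
  have h1 : ((m + 1 : ℕ) : ℝ) + β = (m + β) + 1 := by push_cast; ring
  have h2 : (m : ℝ) + β ≠ 0 := by positivity
  have h3 : (m.factorial : ℝ) ≠ 0 := by positivity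
  rw [risingCoeff, risingCoeff, h1, Real.Gamma_add_one h2, Nat.factorial_succ]
  push_cast
  field_simp

/-- Gautschi's upper bound for a ratio of Gamma values. -/
lemma risingCoeff_le {β : ℝ} (h0 : 0 < β) (h1 : β < 1) {m : ℕ} (hm : 0 < m) :
    risingCoeff β m ≤ (m : ℝ) ^ (β - 1) := by
  have hm' : (0 : ℝ) < m := by exact_mod_cast hm
  -- Log-convexity of Gamma at `m + β = (1 - β) m + β (m + 1)`.
  have h := Real.Gamma_mul_add_mul_le_rpow_Gamma_mul_rpow_Gamma hm'
    (show (0 : ℝ) < m + 1 by positivity) (sub_pos.2 h1) h0 (by ring)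
  rw [show (1 - β) * m + β * (m + 1 : ℝ) = m + β by ring, Real.Gamma_add_one hm'.ne'] at h
  have hG := Real.Gamma_pos_of_pos hm'
  have hf : (m.factorial : ℝ) = m * Real.Gamma m := by
    rw [← Real.Gamma_add_one hm'.ne', Real.Gamma_nat_eq_factorial]
  rw [risingCoeff, div_le_iff₀ (by positivity), hf]
  refine h.trans (le_of_eq ?_)
  rw [Real.mul_rpow hm'.le hG.le, Real.rpow_sub hm', Real.rpow_one, Real.rpow_sub hG, Real.rpow_one]
  have := Real.rpow_pos_of_pos hG β
  field_simp

/-- Gautschi's lower bound for a ratio of Gamma values. -/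
lemma le_risingCoeff {β : ℝ} (h0 : 0 < β) (h1 : β < 1) (m : ℕ) :
    ((m : ℝ) + 1) ^ (β - 1) ≤ risingCoeff β m := by
  have hm : (0 : ℝ) < m + β := by positivity
  -- Log-convexity again, now at `m + 1 = β (m + β) + (1 - β)(m + β + 1)`.
  have h := Real.Gamma_mul_add_mul_le_rpow_Gamma_mul_rpow_Gamma hm
    (show (0 : ℝ) < m + β + 1 by positivity) h0 (sub_pos.2 h1) (by ring)
  rw [show β * (m + β) + (1 - β) * (m + β + 1) = (m : ℝ) + 1 by ring, Real.Gamma_add_one hm.ne',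
    Real.Gamma_nat_eq_factorial] at h
  have hG := Real.Gamma_pos_of_pos hm
  have h2 : Real.Gamma (m + β) ^ β * ((m + β) * Real.Gamma (m + β)) ^ (1 - β) =
      (m + β) ^ (1 - β) * Real.Gamma (m + β) := by
    rw [Real.mul_rpow hm.le hG.le, Real.rpow_sub hG, Real.rpow_one]
    have := Real.rpow_pos_of_pos hG β
    field_simp
  rw [h2] at h
  rw [risingCoeff, le_div_iff₀ (by positivity)]
  have h3 : ((m : ℝ) + β) ^ (1 - β) ≤ (m + 1) ^ (1 - β) :=
    Real.rpow_le_rpow hm.le (by linarith) (by linarith)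
  have h4 : ((m : ℝ) + 1) ^ (β - 1) * (m + 1) ^ (1 - β) = 1 := by
    rw [← Real.rpow_add (by positivity)]; simp
  calc ((m : ℝ) + 1) ^ (β - 1) * m.factorial
      ≤ ((m : ℝ) + 1) ^ (β - 1) * ((m + 1) ^ (1 - β) * Real.Gamma (m + β)) := by
        gcongr
        exact h.trans (by gcongr)
    _ = Real.Gamma (m + β) := by rw [← mul_assoc, h4, one_mul]

lemma glWeight_zero {α : ℝ} (h0 : 0 < α) : glWeight α 0 = 1 := by
  have := Real.Gamma_pos_of_pos (show 0 < α + 1 by positivity)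
  simp [glWeight, this.ne']

lemma sub_natCast_ne_zero {α : ℝ} (h0 : 0 < α) (h1 : α < 1) (j : ℕ) : α - j ≠ 0 := by
  rcases Nat.eq_zero_or_pos j with rfl | hj
  · simpa using h0.ne'
  · have : (1 : ℝ) ≤ j := by exact_mod_cast hj
    linarith

/-- The functional equation of Gamma in the denominator. As `α` is not an integer, no Gamma factor
sits at a pole, where its default value `0` would spoil the division. -/
lemma glWeight_succ {α : ℝ} (h0 : 0 < α) (h1 : α < 1) (j : ℕ) :
    ((j : ℝ) + 1) * glWeight α (j + 1) = (j - α) * glWeight α j := by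
  have hj := sub_natCast_ne_zero h0 h1 j
  have hG : Real.Gamma (α - j) ≠ 0 := by
    refine Real.Gamma_ne_zero fun m hm => ?_
    have hmj := sub_natCast_ne_zero h0 h1 (j - m)
    rcases le_total m j with h | h
    · rw [Nat.cast_sub h] at hmj
      apply hmj; linarith
    · have : (j : ℝ) ≤ m := by exact_mod_cast h
      linarith
  have hf : (j.factorial : ℝ) ≠ 0 := by positivity
  rw [glWeight, glWeight, Real.Gamma_add_one hj, Nat.factorial_succ, pow_succ,
    show α - ((j + 1 : ℕ) : ℝ) + 1 = α - j by push_cast; ring]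
  push_cast
  field_simp
  ring

/-- The partial sums of the weights are `Γ(n + 1 - α) / (Γ(1 - α) n!)`. -/
lemma sum_glWeight {α : ℝ} (h0 : 0 < α) (h1 : α < 1) (n : ℕ) :
    ∑ j ∈ Finset.range (n + 1), glWeight α j
      = risingCoeff (1 - α) n / Real.Gamma (1 - α) ∧
    ((n : ℝ) + 1) * glWeight α (n + 1) = - α * (risingCoeff (1 - α) n / Real.Gamma (1 - α)) := by
  have h1' : 0 < 1 - α := by linarith
  have hG := Real.Gamma_pos_of_pos h1'
  -- The second identity is the increment needed for the first; its own inductive step only compares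
  -- the recurrences of the two coefficient sequences.
  induction n with
  | zero =>
    have := glWeight_succ h0 h1 0
    simp only [Nat.cast_zero, zero_add, one_mul, glWeight_zero h0] at this
    simp [risingCoeff_zero, hG.ne', glWeight_zero h0, this]
  | succ n ih =>
    obtain ⟨ih1, ih2⟩ := ih
    have hr := risingCoeff_succ h1' n
    have hn : (n : ℝ) + 1 ≠ 0 := by positivity
    have h : ∑ j ∈ Finset.range (n + 1 + 1), glWeight α j
        = risingCoeff (1 - α) (n + 1) / Real.Gamma (1 - α) := by
      rw [Finset.sum_range_succ, ih1]
      apply mul_left_cancel₀ hn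
      rw [mul_add, ih2, ← mul_div_assoc ((n : ℝ) + 1) (risingCoeff _ (n + 1)), hr]
      ring
    refine ⟨h, ?_⟩
    have hw := glWeight_succ h0 h1 (n + 1)
    rw [hw]
    apply mul_left_cancel₀ hn
    push_cast
    rw [mul_left_comm, ih2]
    linear_combination (α / Real.Gamma (1 - α)) * hr

lemma glWeight_succ_neg {α : ℝ} (h0 : 0 < α) (h1 : α < 1) (n : ℕ) : glWeight α (n + 1) < 0 := by
  have h := (sum_glWeight h0 h1 n).2
  have h1' : 0 < 1 - α := by linarith
  have hG := Real.Gamma_pos_of_pos h1'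
  have hr := risingCoeff_pos h1' n
  have : ((n : ℝ) + 1) * glWeight α (n + 1) < 0 := by
    rw [h, neg_mul, neg_lt_zero]; positivity
  exact (mul_neg_iff.1 this).resolve_right (fun h => by linarith [h.1, (n.cast_nonneg : (0 : ℝ) ≤ n)])
    |>.2

/-- Only the weight of index `0` is positive, so this is `1` minus a partial sum of the weights. The
quantity subtracted is the margin in the maximum principle. -/
lemma sum_abs_glWeight {α : ℝ} (h0 : 0 < α) (h1 : α < 1) (n : ℕ) :
    ∑ j ∈ Finset.range n, |glWeight α (j + 1)|
      = 1 - risingCoeff (1 - α) n / Real.Gamma (1 - α) := by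
  rw [← (sum_glWeight h0 h1 n).1, Finset.sum_range_succ', glWeight_zero h0]
  simp only [abs_of_neg (glWeight_succ_neg h0 h1 _), Finset.sum_neg_distrib]
  ring

lemma summable_abs_glWeight {α : ℝ} (h0 : 0 < α) (h1 : α < 1) :
    Summable fun j => |glWeight α j| := by
  rw [← summable_nat_add_iff 1]
  refine summable_of_sum_range_le (c := 1) (fun _ => abs_nonneg _) fun n => ?_
  have h1' : 0 < 1 - α := by linarith
  have hG := Real.Gamma_pos_of_pos h1'
  have hr := risingCoeff_pos h1' n
  rw [sum_abs_glWeight h0 h1]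
  have : 0 < risingCoeff (1 - α) n / Real.Gamma (1 - α) := by positivity
  linarith

/-- Gautschi's bound squeezes the partial sums between `0` and `n^(-α) / Γ(1 - α)`. Consequently the
difference operator annihilates constants. -/
lemma tsum_glWeight {α : ℝ} (h0 : 0 < α) (h1 : α < 1) : ∑' j, glWeight α j = 0 := by
  have h1' : 0 < 1 - α := by linarith
  have hG := Real.Gamma_pos_of_pos h1'
  have hs := ((summable_abs_glWeight h0 h1).of_abs.hasSum.tendsto_sum_nat).comp
    (tendsto_add_atTop_nat 1)
  refine tendsto_nhds_unique hs ?_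
  have hz : Tendsto (fun n : ℕ => (n : ℝ) ^ (-α) / Real.Gamma (1 - α)) atTop (𝓝 0) := by
    simpa using ((tendsto_rpow_neg_atTop h0).comp tendsto_natCast_atTop_atTop).div_const
      (Real.Gamma (1 - α))
  refine tendsto_of_tendsto_of_tendsto_of_le_of_le' tendsto_const_nhds hz
    (Eventually.of_forall fun n => ?_) ?_
  · have hr := risingCoeff_pos h1' n
    simp only [Function.comp, (sum_glWeight h0 h1 n).1]
    positivity
  · filter_upwards [eventually_gt_atTop 0] with n hn
    simp only [Function.comp, (sum_glWeight h0 h1 n).1]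
    have := risingCoeff_le h1' (by linarith) hn
    rw [show 1 - α - 1 = -α by ring] at this
    gcongr

/-- The weights are, up to the factor `Γ(α)`, the convolution inverse of the rising
coefficients. -/
lemma sum_glWeight_mul_risingCoeff {α : ℝ} (h0 : 0 < α) (h1 : α < 1) (n : ℕ) :
    ∑ j ∈ Finset.range (n + 1 + 1), glWeight α j * risingCoeff α (n + 1 - j) = 0 := by
  -- With generating series `A`, `B`, the recurrences read `(1-z)A' = -αA` and `(1-z)B' = αB`, hence
  -- `(1-z)(AB)' = 0`. This is the coefficientwise form; `e1` is the Leibniz rule.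
  have key : ∀ n : ℕ, ((n : ℝ) + 1) *
      ∑ j ∈ Finset.range (n + 1 + 1), glWeight α j * risingCoeff α (n + 1 - j) =
      n * ∑ j ∈ Finset.range (n + 1), glWeight α j * risingCoeff α (n - j) := by
    intro n
    have e1 : ((n : ℝ) + 1) *
        ∑ j ∈ Finset.range (n + 1 + 1), glWeight α j * risingCoeff α (n + 1 - j) =
        ∑ j ∈ Finset.range (n + 1 + 1), (j : ℝ) * glWeight α j * risingCoeff α (n + 1 - j) +
        ∑ j ∈ Finset.range (n + 1 + 1),
          glWeight α j * (((n + 1 - j : ℕ) : ℝ) * risingCoeff α (n + 1 - j)) := by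
      rw [← Finset.sum_add_distrib, Finset.mul_sum]
      refine Finset.sum_congr rfl fun j hj => ?_
      rw [Nat.cast_sub (by have := Finset.mem_range.1 hj; omega)]
      push_cast
      ring
    rw [e1, Finset.sum_range_succ', Finset.sum_range_succ _ (n + 1)]
    simp only [Nat.cast_zero, zero_mul, add_zero, Nat.sub_self, mul_zero]
    rw [← Finset.sum_add_distrib, Finset.mul_sum]
    refine Finset.sum_congr rfl fun j hj => ?_
    have hj' : j ≤ n := by have := Finset.mem_range.1 hj; omega
    have h2 : n + 1 - j = (n - j) + 1 := by omega
    have hw := glWeight_succ h0 h1 j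
    have hr := risingCoeff_succ h0 (n - j)
    rw [h2, Nat.add_sub_add_right]
    push_cast
    rw [hw, hr, Nat.cast_sub hj']
    ring
  induction n with
  | zero => simpa using key 0
  | succ n ih =>
    have := key (n + 1)
    rw [ih, mul_zero] at this
    exact (mul_eq_zero.1 this).resolve_left (by positivity)

/-! ### A maximum principle and uniqueness -/

section MaximumPrinciple

variable {𝕜 : Type*} [RCLike 𝕜]

/-- If `‖w‖` is maximal at `t > 0` among the points of `[0, t]`, and `w` vanishes on `(-∞, 0]`, then
the Grünwald–Letnikov sum at `t` is bounded below. -/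
lemma norm_mul_le_norm_tsum_glWeight {α : ℝ} (h0 : 0 < α) (h1 : α < 1) {w : ℝ → 𝕜} {t : ℝ}
    (ht : 0 < t) (hw : ∀ s ≤ 0, w s = 0) (hmax : ∀ s ∈ Icc 0 t, ‖w s‖ ≤ ‖w t‖) (n : ℕ) :
    ‖w t‖ * (risingCoeff (1 - α) n / Real.Gamma (1 - α)) ≤
      ‖∑' j : ℕ, glWeight α j • w (t - j * (t / (n + 1)))‖ := by
  have hn : (0 : ℝ) < n + 1 := by positivity
  -- With step `t / (n + 1)` the index `j = n + 1` lands at the origin, so only `j ≤ n` contributes.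
  have hsupp : ∀ j ∉ Finset.range (n + 1), glWeight α j • w (t - j * (t / (n + 1))) = 0 := by
    intro j hj
    rw [hw, smul_zero]
    have hj' : (n : ℝ) + 1 ≤ j := by
      have : n + 1 ≤ j := by simpa using hj
      exact_mod_cast this
    rw [sub_nonpos, mul_div_assoc', le_div_iff₀ hn, mul_comm]
    gcongr
  rw [tsum_eq_sum hsupp, Finset.sum_range_succ']
  have hb : ‖∑ j ∈ Finset.range n, glWeight α (j + 1) • w (t - (j + 1 : ℕ) * (t / (n + 1)))‖ ≤
      (∑ j ∈ Finset.range n, |glWeight α (j + 1)|) * ‖w t‖ := by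
    rw [Finset.sum_mul]
    refine norm_sum_le_of_le _ fun j hj => ?_
    rw [norm_smul, Real.norm_eq_abs]
    have hj' : ((j + 1 : ℕ) : ℝ) ≤ n + 1 := by
      have : j + 1 ≤ n + 1 := by have := Finset.mem_range.1 hj; omega
      exact_mod_cast this
    refine mul_le_mul_of_nonneg_left (hmax _ ⟨?_, ?_⟩) (abs_nonneg _)
    · rw [sub_nonneg, mul_div_assoc', div_le_iff₀ hn, mul_comm]
      gcongr
    · rw [sub_le_self_iff]; positivity
  rw [sum_abs_glWeight h0 h1] at hb
  have h2 := norm_sub_le_norm_add (glWeight α 0 • w (t - (0 : ℕ) * (t / (n + 1))))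
    (∑ j ∈ Finset.range n, glWeight α (j + 1) • w (t - (j + 1 : ℕ) * (t / (n + 1))))
  rw [add_comm]
  refine le_trans ?_ h2
  simp only [glWeight_zero h0, Nat.cast_zero, zero_mul, sub_zero, one_smul]
  linarith

/-- A continuous function vanishing on `(-∞, 0]` whose Grünwald–Letnikov derivative vanishes on
`(0, T]` vanishes on `[0, T]`. -/
theorem eq_zero_of_hasGLDerivAt_zero {α : ℝ} (h0 : 0 < α) (h1 : α < 1) {w : ℝ → 𝕜} {T : ℝ}
    (hw : ∀ s ≤ 0, w s = 0) (hc : ContinuousOn w (Icc 0 T))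
    (hD : ∀ t ∈ Ioc 0 T, HasGLDerivAt α w 0 t) : ∀ t ≤ T, w t = 0 := by
  rcases lt_or_ge T 0 with hT | hT
  · exact fun t ht => hw t (ht.trans hT.le)
  obtain ⟨m, hm, hmax⟩ := isCompact_Icc.exists_isMaxOn (nonempty_Icc.2 hT) hc.norm
  have hmax' : ∀ s ∈ Icc 0 T, ‖w s‖ ≤ ‖w m‖ := fun s hs => hmax hs
  suffices h : ‖w m‖ ≤ 0 by
    intro t ht
    rcases le_total t 0 with ht0 | ht0
    · exact hw t ht0
    · exact norm_le_zero_iff.1 ((hmax' t ⟨ht0, ht⟩).trans h)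
  rcases hm.1.eq_or_lt with rfl | hm0
  · simp [hw 0 le_rfl]
  have h1' : 0 < 1 - α := by linarith
  have hG := Real.Gamma_pos_of_pos h1'
  have hh : Tendsto (fun n : ℕ => m / ((n : ℝ) + 1)) atTop (𝓝[>] 0) := by
    refine tendsto_nhdsWithin_iff.2 ⟨?_, Eventually.of_forall fun n => ?_⟩
    · simpa [div_eq_mul_inv] using (tendsto_one_div_add_atTop_nhds_zero_nat (𝕜 := ℝ)).const_mul m
    · simp only [mem_Ioi]; positivity
  have hlim := ((hD m ⟨hm0, hm.2⟩).2.comp hh).norm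
  rw [norm_zero] at hlim
  -- For `h = m / (n + 1)`, the factor `h^(-α)` cancels the `(n + 1)^(-α)` from Gautschi's lower
  -- bound, leaving a bound independent of `n` that survives the limit.
  have hle : ‖w m‖ * (m ^ (-α) / Real.Gamma (1 - α)) ≤ 0 := by
    refine ge_of_tendsto' hlim fun n => ?_
    have hn : (0 : ℝ) < n + 1 := by positivity
    have hb := norm_mul_le_norm_tsum_glWeight h0 h1 hm0 hw
      (fun s hs => hmax' s ⟨hs.1, hs.2.trans hm.2⟩) n
    have hr := le_risingCoeff h1' (by linarith) n
    rw [show 1 - α - 1 = -α by ring] at hr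
    have hp : 0 < (m / ((n : ℝ) + 1)) ^ α := by positivity
    simp only [Function.comp, norm_smul, norm_div, norm_one, Real.norm_of_nonneg hp.le]
    refine le_trans ?_ (mul_le_mul_of_nonneg_left hb (by positivity))
    have e : ‖w m‖ * (m ^ (-α) / Real.Gamma (1 - α)) =
        1 / (m / ((n : ℝ) + 1)) ^ α * (‖w m‖ * (((n : ℝ) + 1) ^ (-α) / Real.Gamma (1 - α))) := by
      rw [Real.div_rpow hm0.le hn.le, Real.rpow_neg hm0.le, Real.rpow_neg hn.le]
      field_simp
    rw [e]
    gcongr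
  have hp : 0 < m ^ (-α) / Real.Gamma (1 - α) := by positivity
  exact nonpos_of_mul_nonpos_left hle hp

lemma HasGLDerivAt.sub {α : ℝ} {u v : ℝ → 𝕜} {a b : 𝕜} {t : ℝ} (hu : HasGLDerivAt α u a t)
    (hv : HasGLDerivAt α v b t) : HasGLDerivAt α (fun s => u s - v s) (a - b) t := by
  refine ⟨?_, ?_⟩
  · filter_upwards [hu.1, hv.1] with h h1 h2
    simpa only [smul_sub] using h1.sub h2
  · refine (hu.2.sub hv.2).congr' ?_
    filter_upwards [hu.1, hv.1] with h h1 h2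
    simp only [smul_sub]
    rw [h1.tsum_sub h2, smul_sub]

/-- Solutions of the delay equation are unique on `[-τ, ∞)`. -/
theorem IsModifiedFDDESolution.eqOn {α τ : ℝ} (h0 : 0 < α) (h1 : α < 1) (hτ : 0 < τ) {l : 𝕜}
    {φ f y z : ℝ → 𝕜} (hy : IsModifiedFDDESolution α τ l φ f y)
    (hz : IsModifiedFDDESolution α τ l φ f z) : EqOn y z (Ici (-τ)) := by
  -- Method of steps: up to time `(n + 1) τ` the delayed argument is at most `n τ`, where the
  -- solutions already agree.
  have key : ∀ n : ℕ, ∀ t, -τ ≤ t → t ≤ n * τ → y t = z t := by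
    intro n
    induction n with
    | zero =>
      intro t ht ht'
      rw [hy.history t ⟨ht, by simpa using ht'⟩, hz.history t ⟨ht, by simpa using ht'⟩]
    | succ n ih =>
      intro t ht ht'
      have hdiff : ∀ s, 0 ≤ s → glueHistory τ φ y s - glueHistory τ φ z s = y s - z s := by
        intro s hs
        rcases hs.eq_or_lt with rfl | hs
        · have := ih 0 (by linarith) (by positivity)
          simp [glueHistory, this]
        · simp [glueHistory, hs.not_ge]
      have hw := eq_zero_of_hasGLDerivAt_zero h0 h1 (T := (n + 1 : ℕ) * τ)
        (w := fun s => glueHistory τ φ y s - glueHistory τ φ z s)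
        (fun s hs => by simp [glueHistory, hs]) ?_ ?_
      · rcases le_total t 0 with h | h
        · exact ih t ht (h.trans (by positivity))
        · have := hw t ht'
          simp only [hdiff t h] at this
          exact sub_eq_zero.1 this
      · refine ((hy.continuousOn.sub hz.continuousOn).mono
          (fun s hs => mem_Ici.2 (by linarith [hs.1]))).congr fun s hs => hdiff s hs.1
      · intro s hs
        have h := HasGLDerivAt.sub (hy.equation s hs.1) (hz.equation s hs.1)
        have e : y (s - τ) = z (s - τ) := by
          refine ih _ (by linarith [hs.1]) ?_
          have := hs.2
          push_cast at this
          linarith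
        rwa [e, sub_self] at h
  intro t ht
  obtain ⟨n, hn⟩ := exists_nat_ge (t / τ)
  exact key n t ht (by rwa [div_le_iff₀ hτ] at hn)

end MaximumPrinciple

open MeasureTheory

/-! ### The Riemann–Liouville integral and its Grünwald–Letnikov derivative -/

/-- The kernel `x ^ (β - 1) / Γ(β)` on `(0, ∞)`, extended by zero. -/
noncomputable def rlKernel (β : ℝ) : ℝ → ℝ :=
  (Ioi 0).indicator fun x => x ^ (β - 1) / Real.Gamma β

/-- The Riemann–Liouville integral of order `β`, with lower limit `-∞`. -/
noncomputable def rlIntegral {𝕜 : Type*} [RCLike 𝕜] (β : ℝ) (g : ℝ → 𝕜) (t : ℝ) : 𝕜 :=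
  ∫ x, rlKernel β x • g (t - x)

/-- The difference between the kernel `x ^ (α - 1)` and the step function with the values
`risingCoeff α`. -/
noncomputable def kernelDefect (α x : ℝ) : ℝ :=
  x ^ (α - 1) - risingCoeff α ⌊x⌋₊

lemma measurable_kernelDefect (α : ℝ) : Measurable (kernelDefect α) := by
  unfold kernelDefect
  exact (measurable_id.pow_const _).sub
    ((measurable_from_nat (f := risingCoeff α)).comp Nat.measurable_floor)

/-- For `n = ⌊x⌋`, Gautschi's bounds place both the kernel and the step value between `(n+1)^(α-1)`
and `n^(α-1)`, whose gap is one order smaller. The exponent `α - 2 < -1` makes the defect integrable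
at infinity. -/
lemma abs_kernelDefect_le {α : ℝ} (h0 : 0 < α) (h1 : α < 1) {x : ℝ} (hx : 1 ≤ x) :
    |kernelDefect α x| ≤ 2 * x ^ (α - 2) := by
  set n := ⌊x⌋₊ with hn
  have hx0 : 0 < x := by linarith
  have hn1 : 1 ≤ n := Nat.le_floor (by simpa using hx)
  have hn1' : (1 : ℝ) ≤ n := by exact_mod_cast hn1
  have hn0 : (0 : ℝ) < n := by linarith
  have hnx : (n : ℝ) ≤ x := Nat.floor_le hx0.le
  have hxn : x ≤ n + 1 := (Nat.lt_floor_add_one x).le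
  have hα : α - 1 ≤ 0 := by linarith
  have a1 : x ^ (α - 1) ≤ (n : ℝ) ^ (α - 1) := Real.rpow_le_rpow_of_nonpos hn0 hnx hα
  have a2 : ((n : ℝ) + 1) ^ (α - 1) ≤ x ^ (α - 1) := Real.rpow_le_rpow_of_nonpos hx0 hxn hα
  have b1 := risingCoeff_le h0 h1 hn1
  have b2 := le_risingCoeff h0 h1 n
  have c1 : |kernelDefect α x| ≤ (n : ℝ) ^ (α - 1) - ((n : ℝ) + 1) ^ (α - 1) := by
    rw [kernelDefect, abs_le]
    constructor <;> linarith
  have c2 : (n : ℝ) ^ (α - 1) - ((n : ℝ) + 1) ^ (α - 1) ≤ (n : ℝ) ^ (α - 1) / (n + 1) := by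
    -- Uses `α - 1 ≥ -1` on the base `(n + 1) / n ≥ 1`.
    have hr : (n : ℝ) ^ (α - 1) * (n / (n + 1)) ≤ ((n : ℝ) + 1) ^ (α - 1) := by
      have e : ((n : ℝ) + 1) ^ (α - 1) = n ^ (α - 1) * ((n + 1) / n) ^ (α - 1) := by
        rw [← Real.mul_rpow hn0.le (by positivity)]
        congr 1
        field_simp
      rw [e]
      gcongr
      have h3 : (n : ℝ) / (n + 1) = ((n + 1) / n) ^ (-1 : ℝ) := by
        rw [Real.rpow_neg_one, inv_div]
      rw [h3]
      refine Real.rpow_le_rpow_of_exponent_le ?_ (by linarith)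
      rw [le_div_iff₀ hn0]; linarith
    have h4 : (n : ℝ) ^ (α - 1) / (n + 1) = (n : ℝ) ^ (α - 1) - (n : ℝ) ^ (α - 1) * (n / (n + 1)) := by
      field_simp; ring
    linarith
  have c3 : (n : ℝ) ^ (α - 1) ≤ 2 * x ^ (α - 1) := by
    have h2x : x / 2 ≤ n := by linarith
    have h5 := Real.rpow_le_rpow_of_nonpos (by positivity) h2x hα
    refine h5.trans ?_
    rw [Real.div_rpow hx0.le (by norm_num), div_eq_mul_inv, ← Real.rpow_neg (by norm_num), mul_comm]
    gcongr
    calc (2 : ℝ) ^ (-(α - 1)) ≤ 2 ^ (1 : ℝ) :=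
          Real.rpow_le_rpow_of_exponent_le (by norm_num) (by linarith)
      _ = 2 := Real.rpow_one 2
  have e : x ^ (α - 2) = x ^ (α - 1) / x := by
    rw [show α - 2 = α - 1 - 1 by ring, Real.rpow_sub_one hx0.ne']
  calc |kernelDefect α x| ≤ (n : ℝ) ^ (α - 1) / (n + 1) := c1.trans c2
    _ ≤ 2 * x ^ (α - 1) / x := by gcongr
    _ = 2 * x ^ (α - 2) := by rw [e]; ring

lemma risingCoeff_le_const {α : ℝ} (h0 : 0 < α) (h1 : α < 1) (m : ℕ) :
    risingCoeff α m ≤ Real.Gamma α + 1 := by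
  have hG := Real.Gamma_pos_of_pos h0
  rcases Nat.eq_zero_or_pos m with rfl | hm
  · rw [risingCoeff_zero]; linarith
  · have hm' : (1 : ℝ) ≤ m := by exact_mod_cast hm
    have := (risingCoeff_le h0 h1 hm).trans (Real.rpow_le_one_of_one_le_of_nonpos hm' (by linarith))
    linarith

lemma integrableOn_kernelDefect {α : ℝ} (h0 : 0 < α) (h1 : α < 1) :
    IntegrableOn (kernelDefect α) (Ioi 0) := by
  rw [← Ioc_union_Ioi_eq_Ioi zero_le_one]
  refine IntegrableOn.union ?_ ?_
  · have i1 : IntegrableOn (fun x : ℝ => x ^ (α - 1)) (Ioc 0 1) := by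
      rw [← intervalIntegrable_iff_integrableOn_Ioc_of_le zero_le_one]
      exact intervalIntegral.intervalIntegrable_rpow' (by linarith)
    refine i1.sub ?_
    refine Measure.integrableOn_of_bounded (M := Real.Gamma α + 1) (by simp) ?_ ?_
    · exact ((measurable_from_nat (f := risingCoeff α)).comp
        Nat.measurable_floor).aestronglyMeasurable
    · refine Eventually.of_forall fun x => ?_
      rw [Real.norm_of_nonneg (risingCoeff_pos h0 _).le]
      exact risingCoeff_le_const h0 h1 _
  · refine Integrable.mono' ((integrableOn_Ioi_rpow_of_lt (a := α - 2) (by linarith)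
      zero_lt_one).const_mul 2) (measurable_kernelDefect α).aestronglyMeasurable ?_
    filter_upwards [ae_restrict_mem measurableSet_Ioi] with x hx
    exact abs_kernelDefect_le h0 h1 (mem_Ioi.1 hx).le

section KeyLemma

variable {𝕜 : Type*} [RCLike 𝕜]

/-- Rescaling the Riemann–Liouville integral. -/
lemma rlIntegral_sub_mul {α : ℝ} (g : ℝ → 𝕜) (t : ℝ) {h : ℝ} (hh : 0 < h) (j : ℕ) :
    (1 / h ^ α) • rlIntegral α g (t - j * h) =
      (1 / Real.Gamma α) • ∫ x in Ioi (0 : ℝ), x ^ (α - 1) • g (t - h * (x + j)) := by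
  have e := Measure.integral_comp_mul_left (fun x => rlKernel α x • g (t - j * h - x)) h
  rw [rlIntegral]
  have e2 : ∫ x, rlKernel α x • g (t - j * h - x) =
      h • ∫ x, rlKernel α (h * x) • g (t - j * h - h * x) := by
    rw [e, abs_of_pos (inv_pos.2 hh), smul_smul, mul_inv_cancel₀ hh.ne', one_smul]
  rw [e2, ← integral_indicator measurableSet_Ioi, smul_smul, ← integral_smul, ← integral_smul]
  congr 1
  ext x
  by_cases hx : 0 < x
  · have hhx : 0 < h * x := by positivity
    simp only [rlKernel, indicator, mem_Ioi, hx, hhx, if_true]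
    rw [smul_smul, smul_smul, show t - j * h - h * x = t - h * (x + j) by ring,
      Real.mul_rpow hh.le hx.le, Real.rpow_sub_one hh.ne']
    congr 1
    have := Real.rpow_pos_of_pos hh α
    field_simp
  · have hhx : ¬ 0 < h * x := by
      simpa [hh] using hx
    simp [rlKernel, indicator, hx, hhx]

variable {α : ℝ} {g : ℝ → 𝕜} {a t M : ℝ}

lemma integrableOn_kernelDefect_smul (h0 : 0 < α) (h1 : α < 1) (hg : Measurable g)
    (hM : ∀ s ≤ t, ‖g s‖ ≤ M) {h : ℝ} (hh : 0 < h) (j : ℕ) :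
    IntegrableOn (fun x => kernelDefect α x • g (t - h * (x + j))) (Ioi 0) := by
  refine Integrable.mono' ((integrableOn_kernelDefect h0 h1).norm.mul_const M)
    ((measurable_kernelDefect α).smul (hg.comp (by fun_prop))).aestronglyMeasurable ?_
  filter_upwards [ae_restrict_mem measurableSet_Ioi] with x hx
  rw [norm_smul]
  gcongr
  refine hM _ (sub_le_self _ ?_)
  have := mem_Ioi.1 hx
  positivity

/-- The step function alone is not integrable at infinity; the vanishing of `g` to the left of `a`
confines the integrand to a bounded interval. -/
lemma integrableOn_risingCoeff_smul (h0 : 0 < α) (h1 : α < 1) (hg : Measurable g)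
    (ha : ∀ s ≤ a, g s = 0) (hM : ∀ s ≤ t, ‖g s‖ ≤ M) {h : ℝ} (hh : 0 < h) (j : ℕ) :
    IntegrableOn (fun x => risingCoeff α ⌊x⌋₊ • g (t - h * (x + j))) (Ioi 0) := by
  have hC : 0 ≤ Real.Gamma α + 1 := by have := Real.Gamma_pos_of_pos h0; linarith
  have hM0 : 0 ≤ M := (norm_nonneg _).trans (hM t le_rfl)
  refine Integrable.mono' (g := (Ioc 0 ((t - a) / h)).indicator fun _ => (Real.Gamma α + 1) * M)
    ?_ ?_ ?_
  · refine Integrable.integrableOn ?_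
    rw [integrable_indicator_iff measurableSet_Ioc]
    exact integrableOn_const (by simp)
  · exact (((measurable_from_nat (f := risingCoeff α)).comp Nat.measurable_floor).smul
      (hg.comp (by fun_prop))).aestronglyMeasurable
  · filter_upwards [ae_restrict_mem measurableSet_Ioi] with x hx
    have hx := mem_Ioi.1 hx
    by_cases hxa : x ≤ (t - a) / h
    · rw [indicator_of_mem (show x ∈ Ioc 0 ((t - a) / h) from ⟨hx, hxa⟩), norm_smul,
        Real.norm_of_nonneg (risingCoeff_pos h0 _).le]
      have := risingCoeff_le_const h0 h1 ⌊x⌋₊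
      gcongr
      exact hM _ (sub_le_self _ (by positivity))
    · rw [ha, smul_zero, norm_zero]
      · exact indicator_nonneg (fun _ _ => by positivity) _
      · rw [not_le, div_lt_iff₀ hh] at hxa
        have : 0 ≤ h * j := by positivity
        nlinarith

/-- The step part of a rescaled Riemann–Liouville integral, as a finite sum. -/
lemma integral_risingCoeff_smul (h0 : 0 < α) (h1 : α < 1) (hg : Measurable g)
    (ha : ∀ s ≤ a, g s = 0) (hM : ∀ s ≤ t, ‖g s‖ ≤ M) {h : ℝ} (hh : 0 < h) {N : ℕ}
    (hN : (t - a) / h ≤ N) (j : ℕ) :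
    ∫ x in Ioi (0 : ℝ), risingCoeff α ⌊x⌋₊ • g (t - h * (x + j)) =
      ∑ m ∈ Finset.range (N - j), risingCoeff α m •
        ∫ x in (j + m : ℝ)..(j + m + 1), g (t - h * x) := by
  have hi := integrableOn_risingCoeff_smul h0 h1 hg ha hM hh j
  have hii : ∀ c d : ℝ, 0 ≤ c → c ≤ d → IntervalIntegrable
      (fun x => risingCoeff α ⌊x⌋₊ • g (t - h * (x + j))) volume c d := by
    intro c d hc hcd
    rw [intervalIntegrable_iff_integrableOn_Ioc_of_le hcd]
    exact hi.mono_set fun x hx => lt_of_le_of_lt hc hx.1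
  -- Truncated subtraction is harmless: if `j ≥ N`, the integrand vanishes for all `x > 0` and the
  -- sum is empty.
  have hz : ∀ x : ℝ, ((N - j : ℕ) : ℝ) < x → g (t - h * (x + j)) = 0 := by
    intro x hx
    refine ha _ ?_
    have h2 : (N : ℝ) ≤ (N - j : ℕ) + j := by
      have : N ≤ (N - j) + j := by omega
      exact_mod_cast this
    rw [div_le_iff₀ hh] at hN
    nlinarith
  have h3 : ∫ x in Ioi (0 : ℝ), risingCoeff α ⌊x⌋₊ • g (t - h * (x + j)) =
      ∫ x in (0 : ℝ)..((N - j : ℕ) : ℝ), risingCoeff α ⌊x⌋₊ • g (t - h * (x + j)) := by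
    rw [intervalIntegral.integral_of_le (by positivity)]
    refine (setIntegral_eq_of_subset_of_forall_sdiff_eq_zero measurableSet_Ioi
      (fun x hx => hx.1) fun x hx => ?_)
    rw [hz, smul_zero]
    by_contra hcon
    exact hx.2 ⟨hx.1, not_lt.1 hcon⟩
  have h4 := intervalIntegral.sum_integral_adjacent_intervals (n := N - j) (μ := volume)
    (a := fun k : ℕ => (k : ℝ)) (f := fun x => risingCoeff α ⌊x⌋₊ • g (t - h * (x + j)))
    fun k _ => hii _ _ (by positivity) (by simp)
  rw [h3]
  simp only [Nat.cast_zero] at h4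
  rw [← h4]
  refine Finset.sum_congr rfl fun m _ => ?_
  have h5 : ∫ x in (m : ℝ)..((m + 1 : ℕ) : ℝ), risingCoeff α ⌊x⌋₊ • g (t - h * (x + j)) =
      ∫ x in (m : ℝ)..((m + 1 : ℕ) : ℝ), risingCoeff α m • g (t - h * (x + j)) := by
    rw [intervalIntegral.integral_of_le (by simp), intervalIntegral.integral_of_le (by simp),
      integral_Ioc_eq_integral_Ioo, integral_Ioc_eq_integral_Ioo]
    refine setIntegral_congr_fun measurableSet_Ioo fun x hx => ?_
    have : ⌊x⌋₊ = m := by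
      rw [Nat.floor_eq_iff (by have := hx.1; have : (0 : ℝ) ≤ m := by positivity
                               linarith)]
      exact ⟨hx.1.le, by have := hx.2; push_cast at this; exact this⟩
    simp only [this]
  rw [h5, intervalIntegral.integral_smul,
    intervalIntegral.integral_comp_add_right (fun x => g (t - h * x)) (j : ℝ)]
  congr 2 <;> push_cast <;> ring

/-- The step part contributes just an average of `g` over `[t - h, t]`. -/
lemma tsum_integral_risingCoeff_smul (h0 : 0 < α) (h1 : α < 1) (hg : Measurable g)
    (ha : ∀ s ≤ a, g s = 0) (hM : ∀ s ≤ t, ‖g s‖ ≤ M) {h : ℝ} (hh : 0 < h) :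
    HasSum (fun j : ℕ => glWeight α j •
        ∫ x in Ioi (0 : ℝ), risingCoeff α ⌊x⌋₊ • g (t - h * (x + j)))
      (Real.Gamma α • ∫ x in (0 : ℝ)..1, g (t - h * x)) := by
  obtain ⟨N, hN⟩ := exists_nat_ge ((t - a) / h)
  have hN' : (t - a) / h ≤ (N + 1 : ℕ) := hN.trans (by simp)
  have hI := integral_risingCoeff_smul h0 h1 hg ha hM hh hN'
  have hs := hasSum_sum_of_ne_finset_zero (L := .unconditional ℕ) (s := Finset.range (N + 1)) (f := fun j : ℕ =>
    glWeight α j • ∫ x in Ioi (0 : ℝ), risingCoeff α ⌊x⌋₊ • g (t - h * (x + j))) (fun j hj => by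
      have : N + 1 - j = 0 := by simp at hj; omega
      rw [hI, this]; simp)
  convert hs using 1
  simp only [hI, Finset.smul_sum, smul_smul]
  -- The integral depends only on `j + m`, so regrouping along diagonals exposes the convolution of
  -- the two coefficient sequences.
  have hflip := Finset.sum_range_diag_flip (N + 1) (fun j m : ℕ =>
    (glWeight α j * risingCoeff α m) • ∫ x in (j + m : ℝ)..(j + m + 1), g (t - h * x))
  rw [← hflip]
  have hinner : ∀ n : ℕ, ∑ j ∈ Finset.range (n + 1), (glWeight α j * risingCoeff α (n - j)) •
      ∫ x in (j + (n - j : ℕ) : ℝ)..(j + (n - j : ℕ) + 1), g (t - h * x) =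
      (∑ j ∈ Finset.range (n + 1), glWeight α j * risingCoeff α (n - j)) •
        ∫ x in (n : ℝ)..(n + 1), g (t - h * x) := by
    intro n
    rw [Finset.sum_smul]
    refine Finset.sum_congr rfl fun j hj => ?_
    have : (j : ℝ) + (n - j : ℕ) = n := by
      rw [Nat.cast_sub (by have := Finset.mem_range.1 hj; omega)]; ring
    rw [this]
  simp only [hinner]
  -- Only the diagonal `0` survives; using `N + 1` instead of `N` guarantees that it is present.
  rw [Finset.sum_range_succ']
  simp only [sum_glWeight_mul_risingCoeff h0 h1]
  simp [glWeight_zero h0, risingCoeff_zero]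

/-- The Grünwald–Letnikov derivative of order `α` inverts the Riemann–Liouville integral of order
`α` at points of continuity. -/
theorem hasGLDerivAt_rlIntegral (h0 : 0 < α) (h1 : α < 1) (hg : Measurable g)
    (ha : ∀ s ≤ a, g s = 0) (hM : ∀ s ≤ t, ‖g s‖ ≤ M) (hc : ContinuousAt g t) :
    HasGLDerivAt α (rlIntegral α g) (g t) t := by
  have hG := Real.Gamma_pos_of_pos h0
  set I : ℝ → ℕ → 𝕜 := fun h j =>
    ∫ x in Ioi (0 : ℝ), kernelDefect α x • g (t - h * (x + j)) with hI
  set C := ∫ x in Ioi (0 : ℝ), ‖kernelDefect α x‖ * M with hC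
  have hIle : ∀ h > 0, ∀ j, ‖I h j‖ ≤ C := by
    intro h hh j
    refine norm_integral_le_of_norm_le ((integrableOn_kernelDefect h0 h1).norm.mul_const M) ?_
    filter_upwards [ae_restrict_mem measurableSet_Ioi] with x hx
    rw [norm_smul]
    gcongr
    refine hM _ (sub_le_self _ ?_)
    have := mem_Ioi.1 hx
    positivity
  have hsC : Summable fun j => |glWeight α j| * C := (summable_abs_glWeight h0 h1).mul_right C
  have hbd : ∀ h > 0, ∀ j, ‖glWeight α j • I h j‖ ≤ |glWeight α j| * C := by
    intro h hh j
    rw [norm_smul, Real.norm_eq_abs]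
    gcongr
    exact hIle h hh j
  have hsum : ∀ h > 0, HasSum (fun j : ℕ => glWeight α j • (1 / h ^ α) •
      rlIntegral α g (t - j * h))
      ((∫ x in (0 : ℝ)..1, g (t - h * x)) + (1 / Real.Gamma α) • ∑' j, glWeight α j • I h j) := by
    intro h hh
    have s1 := tsum_integral_risingCoeff_smul h0 h1 hg ha hM hh
    have s2 : Summable fun j => glWeight α j • I h j :=
      Summable.of_norm_bounded hsC (hbd h hh)
    have s3 := (s1.add s2.hasSum).const_smul (1 / Real.Gamma α)
    rw [smul_add, smul_smul, one_div_mul_cancel hG.ne', one_smul] at s3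
    convert s3 using 2 with j
    rw [rlIntegral_sub_mul g t hh j, ← smul_add, ← integral_add
      (integrableOn_risingCoeff_smul h0 h1 hg ha hM hh j)
      (integrableOn_kernelDefect_smul h0 h1 hg hM hh j), smul_comm]
    congr 3
    ext x
    rw [← add_smul, kernelDefect]
    congr 1
    ring
  have hev : ∀ᶠ h : ℝ in 𝓝[>] 0, 0 < h := eventually_mem_nhdsWithin
  refine ⟨?_, ?_⟩
  · filter_upwards [hev] with h hh
    have hp : 0 < h ^ α := by positivity
    have := (hsum h hh).summable.const_smul (h ^ α)
    refine this.congr fun j => ?_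
    rw [smul_comm (h ^ α), smul_smul (h ^ α), mul_one_div_cancel hp.ne', one_smul]
  have hlim : ∀ x : ℝ, Tendsto (fun h : ℝ => g (t - h * x)) (𝓝[>] 0) (𝓝 (g t)) := by
    intro x
    have : Tendsto (fun h : ℝ => t - h * x) (𝓝 0) (𝓝 t) := by
      have : Continuous fun h : ℝ => t - h * x := by fun_prop
      simpa using this.tendsto 0
    exact hc.tendsto.comp (this.mono_left nhdsWithin_le_nhds)
  have l1 : Tendsto (fun h : ℝ => ∫ x in (0 : ℝ)..1, g (t - h * x)) (𝓝[>] 0) (𝓝 (g t)) := by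
    have : g t = ∫ x in (0 : ℝ)..1, g t := by simp
    rw [this]
    refine intervalIntegral.tendsto_integral_filter_of_dominated_convergence (fun _ => M) ?_ ?_ ?_ ?_
    · exact Eventually.of_forall fun h => (hg.comp (by fun_prop)).aestronglyMeasurable
    · filter_upwards [hev] with h hh
      refine Eventually.of_forall fun x hx => ?_
      rw [uIoc_of_le zero_le_one] at hx
      exact hM _ (sub_le_self _ (mul_nonneg hh.le hx.1.le))
    · simp
    · exact Eventually.of_forall fun x _ => hlim x
  have l2 : Tendsto (fun h : ℝ => ∑' j, glWeight α j • I h j) (𝓝[>] 0) (𝓝 0) := by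
    -- Zero is rewritten as the termwise limit, so that dominated convergence applies to the sum
    -- and, inside it, to each integral.
    have e : (0 : 𝕜) = ∑' j, glWeight α j • ∫ x in Ioi (0 : ℝ), kernelDefect α x • g t := by
      rw [(summable_abs_glWeight h0 h1).of_abs.tsum_smul_const, tsum_glWeight h0 h1, zero_smul]
    rw [e]
    refine tendsto_tsum_of_dominated_convergence hsC (fun j => ?_) ?_
    · refine Tendsto.const_smul ?_ _
      refine tendsto_integral_filter_of_dominated_convergence (fun x => ‖kernelDefect α x‖ * M)
        ?_ ?_ ((integrableOn_kernelDefect h0 h1).norm.mul_const M) ?_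
      · exact Eventually.of_forall fun h =>
          ((measurable_kernelDefect α).smul (hg.comp (by fun_prop))).aestronglyMeasurable
      · filter_upwards [hev] with h hh
        filter_upwards [ae_restrict_mem measurableSet_Ioi] with x hx
        rw [norm_smul]
        gcongr
        refine hM _ (sub_le_self _ ?_)
        have := mem_Ioi.1 hx
        positivity
      · exact Eventually.of_forall fun x => (hlim _).const_smul _
    · filter_upwards [hev] with h hh
      exact hbd h hh
  have l3 := l1.add (l2.const_smul (1 / Real.Gamma α))
  rw [smul_zero, add_zero] at l3
  refine l3.congr' ?_
  filter_upwards [hev] with h hh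
  rw [← (hsum h hh).tsum_eq]
  simp only [smul_comm _ (1 / h ^ α)]
  rw [tsum_const_smul'']

end KeyLemma

/-! ### The semigroup property -/

lemma rlKernel_of_pos (β : ℝ) {x : ℝ} (hx : 0 < x) :
    rlKernel β x = x ^ (β - 1) / Real.Gamma β := by
  simp [rlKernel, hx]

lemma rlKernel_of_nonpos (β : ℝ) {x : ℝ} (hx : x ≤ 0) : rlKernel β x = 0 := by
  simp [rlKernel, hx.not_gt]

lemma measurable_rlKernel (β : ℝ) : Measurable (rlKernel β) :=
  ((measurable_id.pow_const _).div_const _).indicator measurableSet_Ioi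

lemma rlKernel_nonneg {β : ℝ} (hβ : 0 < β) (x : ℝ) : 0 ≤ rlKernel β x := by
  have := Real.Gamma_pos_of_pos hβ
  exact indicator_nonneg (fun x hx => by have := mem_Ioi.1 hx; positivity) x

lemma rlKernel_mul (β : ℝ) {z : ℝ} (hz : 0 < z) (x : ℝ) :
    rlKernel β (z * x) = z ^ (β - 1) * rlKernel β x := by
  rcases lt_or_ge 0 x with hx | hx
  · rw [rlKernel_of_pos _ hx, rlKernel_of_pos _ (by positivity), Real.mul_rpow hz.le hx.le,
      mul_div_assoc]
  · rw [rlKernel_of_nonpos _ hx, rlKernel_of_nonpos _ (mul_nonpos_of_nonneg_of_nonpos hz.le hx),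
      mul_zero]

/-- Both claims are read off from the real part of the complex beta integral. -/
lemma integral_rpow_mul_one_sub_rpow {a b : ℝ} (ha : 0 < a) (hb : 0 < b) :
    IntegrableOn (fun x : ℝ => x ^ (a - 1) * (1 - x) ^ (b - 1)) (Ioo 0 1) ∧
    ∫ x in Ioo (0 : ℝ) 1, x ^ (a - 1) * (1 - x) ^ (b - 1) = ProbabilityTheory.beta a b := by
  have h := Complex.betaIntegral_convergent (u := a) (v := b) (by simpa) (by simpa)
  rw [intervalIntegrable_iff_integrableOn_Ioo_of_le zero_le_one] at h
  have e : ∀ x ∈ Ioo (0 : ℝ) 1, RCLike.re ((x : ℂ) ^ ((a : ℂ) - 1) * (1 - (x : ℂ)) ^ ((b : ℂ) - 1)) =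
      x ^ (a - 1) * (1 - x) ^ (b - 1) := by
    intro x hx
    have h1 : 0 ≤ 1 - x := by linarith [hx.2]
    have h2 : (x : ℂ) ^ ((a : ℂ) - 1) * (1 - (x : ℂ)) ^ ((b : ℂ) - 1) =
        ((x ^ (a - 1) * (1 - x) ^ (b - 1) : ℝ) : ℂ) := by
      push_cast
      rw [Complex.ofReal_cpow hx.1.le, Complex.ofReal_cpow h1]
      push_cast
      rfl
    rw [h2]; rfl
  constructor
  · exact IntegrableOn.congr_fun h.re e measurableSet_Ioo
  · rw [ProbabilityTheory.beta_eq_betaIntegralReal a b ha hb, Complex.betaIntegral,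
      intervalIntegral.integral_of_le zero_le_one, integral_Ioc_eq_integral_Ioo,
      ← RCLike.re_to_complex, ← integral_re h]
    exact (setIntegral_congr_fun measurableSet_Ioo e).symm

lemma rlKernel_mul_rlKernel_one_sub (a b : ℝ) :
    (fun x => rlKernel a x * rlKernel b (1 - x)) = (Ioo 0 1).indicator fun x =>
      (Real.Gamma a * Real.Gamma b)⁻¹ * (x ^ (a - 1) * (1 - x) ^ (b - 1)) := by
  ext x
  by_cases hx : x ∈ Ioo (0 : ℝ) 1
  · rw [indicator_of_mem hx, rlKernel_of_pos _ hx.1, rlKernel_of_pos _ (by linarith [hx.2]),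
      mul_inv]
    ring
  · rw [indicator_of_notMem hx]
    rcases le_or_gt x 0 with h | h
    · rw [rlKernel_of_nonpos _ h, zero_mul]
    · have : 1 ≤ x := by
        by_contra hc
        exact hx ⟨h, not_le.1 hc⟩
      rw [rlKernel_of_nonpos b (by linarith), mul_zero]

lemma integrable_rlKernel_mul_rlKernel {a b : ℝ} (ha : 0 < a) (hb : 0 < b) (z : ℝ) :
    Integrable fun x => rlKernel a x * rlKernel b (z - x) := by
  rcases le_or_gt z 0 with hz | hz
  · have : (fun x => rlKernel a x * rlKernel b (z - x)) = fun _ => 0 := by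
      ext x
      rcases le_or_gt x 0 with h | h
      · rw [rlKernel_of_nonpos _ h, zero_mul]
      · rw [rlKernel_of_nonpos b (by linarith), mul_zero]
    rw [this]
    exact integrable_zero _ _ _
  · rw [← integrable_comp_mul_left_iff _ hz.ne']
    simp only [rlKernel_mul _ hz, show ∀ x, z - z * x = z * (1 - x) from fun x => by ring]
    have h1 : Integrable fun x => rlKernel a x * rlKernel b (1 - x) := by
      rw [rlKernel_mul_rlKernel_one_sub, integrable_indicator_iff measurableSet_Ioo]
      exact (integral_rpow_mul_one_sub_rpow ha hb).1.const_mul _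
    refine (h1.const_mul (z ^ (a - 1) * z ^ (b - 1))).congr (Eventually.of_forall fun x => ?_)
    ring

/-- For `z > 0`, homogeneity of the kernels reduces the convolution to the beta integral on `(0,
1)`. This is the semigroup law at the level of kernels. -/
lemma integral_rlKernel_mul_rlKernel {a b : ℝ} (ha : 0 < a) (hb : 0 < b) (z : ℝ) :
    ∫ x, rlKernel a x * rlKernel b (z - x) = rlKernel (a + b) z := by
  rcases le_or_gt z 0 with hz | hz
  · rw [rlKernel_of_nonpos _ hz]
    refine integral_eq_zero_of_ae (Eventually.of_forall fun x => ?_)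
    rcases le_or_gt x 0 with h | h
    · simp [rlKernel_of_nonpos _ h]
    · simp [rlKernel_of_nonpos b (show z - x ≤ 0 by linarith)]
  · have e := Measure.integral_comp_mul_left (fun x => rlKernel a x * rlKernel b (z - x)) z
    simp only [rlKernel_mul _ hz, show ∀ x, z - z * x = z * (1 - x) from fun x => by ring] at e
    rw [abs_of_pos (inv_pos.2 hz), smul_eq_mul, eq_inv_mul_iff_mul_eq₀ hz.ne'] at e
    simp only [show ∀ x, z ^ (a - 1) * rlKernel a x * (z ^ (b - 1) * rlKernel b (1 - x)) =
      z ^ (a - 1) * z ^ (b - 1) * (rlKernel a x * rlKernel b (1 - x)) from fun x => by ring] at e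
    rw [← e, integral_const_mul, rlKernel_mul_rlKernel_one_sub, integral_indicator measurableSet_Ioo,
      integral_const_mul, (integral_rpow_mul_one_sub_rpow ha hb).2, rlKernel_of_pos _ hz,
      ProbabilityTheory.beta, show a + b - 1 = 1 + (a - 1) + (b - 1) by ring, Real.rpow_add hz,
      Real.rpow_add hz, Real.rpow_one]
    have h1 := Real.Gamma_pos_of_pos ha
    have h2 := Real.Gamma_pos_of_pos hb
    field_simp

/-! ### Causal functions and their stability under Riemann–Liouville integration -/

section Admissible

variable {𝕜 : Type*} [RCLike 𝕜]

/-- Measurable functions vanishing on `(-∞, a]`, bounded on every `(-∞, T]` and continuous almost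
everywhere. -/
structure IsCausal (a : ℝ) (g : ℝ → 𝕜) : Prop where
  measurable : Measurable g
  ae_continuousAt : ∀ᵐ x, ContinuousAt g x
  eq_zero : ∀ s ≤ a, g s = 0
  bounded : ∀ T, ∃ M, ∀ s ≤ T, ‖g s‖ ≤ M

variable {a : ℝ} {g g' : ℝ → 𝕜}

lemma IsCausal.of_continuous (hg : Continuous g) (h0 : ∀ s ≤ a, g s = 0) : IsCausal a g where
  measurable := hg.measurable
  ae_continuousAt := Eventually.of_forall fun _ => hg.continuousAt
  eq_zero := h0
  bounded T := by
    obtain ⟨M, hM⟩ := (isCompact_Icc (a := a) (b := T)).exists_bound_of_continuousOn hg.continuousOn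
    refine ⟨max M 0, fun s hs => ?_⟩
    rcases le_total s a with h | h
    · rw [h0 s h, norm_zero]; exact le_max_right _ _
    · exact (hM s ⟨h, hs⟩).trans (le_max_left _ _)

lemma IsCausal.add (hg : IsCausal a g) (hg' : IsCausal a g') :
    IsCausal a (fun s => g s + g' s) where
  measurable := hg.measurable.add hg'.measurable
  ae_continuousAt := by
    filter_upwards [hg.ae_continuousAt, hg'.ae_continuousAt] with x h h'
    exact h.add h'
  eq_zero s hs := by rw [hg.eq_zero s hs, hg'.eq_zero s hs, add_zero]
  bounded T := by
    obtain ⟨M, hM⟩ := hg.bounded T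
    obtain ⟨M', hM'⟩ := hg'.bounded T
    exact ⟨M + M', fun s hs => norm_add_le_of_le (hM s hs) (hM' s hs)⟩

lemma IsCausal.norm (hg : IsCausal a g) : IsCausal a (fun s => ‖g s‖) where
  measurable := hg.measurable.norm
  ae_continuousAt := hg.ae_continuousAt.mono fun _ h => h.norm
  eq_zero s hs := by rw [hg.eq_zero s hs, norm_zero]
  bounded T := by simpa using hg.bounded T

lemma integrable_indicator_rlKernel {β : ℝ} (hβ : 0 < β) (R : ℝ) :
    Integrable ((Iic R).indicator (rlKernel β)) := by
  rw [rlKernel, indicator_indicator, Iic_inter_Ioi, integrable_indicator_iff measurableSet_Ioc]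
  refine Integrable.div_const ?_ _
  rcases le_total 0 R with hR | hR
  · exact (intervalIntegrable_iff_integrableOn_Ioc_of_le hR).1
      (intervalIntegral.intervalIntegrable_rpow' (by linarith))
  · rw [Ioc_eq_empty hR.not_gt]; simp

/-- Causality cuts the kernel off at `T - a`, giving one integrable majorant for all `t ≤ T`. -/
lemma IsCausal.norm_rlKernel_smul_le (hg : IsCausal a g) {β : ℝ} (hβ : 0 < β) {t T M : ℝ}
    (htT : t ≤ T) (hM : ∀ s ≤ T, ‖g s‖ ≤ M) (x : ℝ) :
    ‖rlKernel β x • g (t - x)‖ ≤ (Iic (T - a)).indicator (rlKernel β) x * M := by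
  rw [norm_smul, Real.norm_of_nonneg (rlKernel_nonneg hβ x)]
  by_cases hx : x ≤ T - a
  · rw [indicator_of_mem (mem_Iic.2 hx)]
    rcases le_or_gt x 0 with h | h
    · simp [rlKernel_of_nonpos _ h]
    · exact mul_le_mul_of_nonneg_left (hM _ (by linarith)) (rlKernel_nonneg hβ x)
  · rw [hg.eq_zero _ (by linarith), indicator_of_notMem (by simpa using hx)]
    simp

lemma IsCausal.aestronglyMeasurable_rlKernel_smul (hg : IsCausal a g) (β t : ℝ) :
    AEStronglyMeasurable (fun x => rlKernel β x • g (t - x)) :=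
  ((measurable_rlKernel β).smul (hg.measurable.comp (by fun_prop))).aestronglyMeasurable

lemma IsCausal.integrable (hg : IsCausal a g) {β : ℝ} (hβ : 0 < β) (t : ℝ) :
    Integrable fun x => rlKernel β x • g (t - x) := by
  obtain ⟨M, hM⟩ := hg.bounded t
  exact Integrable.mono' ((integrable_indicator_rlKernel hβ (t - a)).mul_const M)
    (hg.aestronglyMeasurable_rlKernel_smul β t)
    (Eventually.of_forall (hg.norm_rlKernel_smul_le hβ le_rfl hM))

/-- Dominated convergence needs continuity of `g` at `t - x` only for almost every `x`, so a jump of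
the forcing at the origin does no harm. -/
lemma IsCausal.continuous_rlIntegral (hg : IsCausal a g) {β : ℝ} (hβ : 0 < β) :
    Continuous (rlIntegral β g) := by
  rw [continuous_iff_continuousAt]
  intro t
  obtain ⟨M, hM⟩ := hg.bounded (t + 1)
  refine continuousAt_of_dominated (bound := fun x =>
    (Iic (t + 1 - a)).indicator (rlKernel β) x * M)
    (Eventually.of_forall (hg.aestronglyMeasurable_rlKernel_smul β)) ?_
    ((integrable_indicator_rlKernel hβ _).mul_const M) ?_
  · filter_upwards [Iio_mem_nhds (lt_add_one t)] with s hs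
    exact Eventually.of_forall (hg.norm_rlKernel_smul_le hβ (mem_Iio.1 hs).le hM)
  · filter_upwards [(Measure.measurePreserving_sub_left volume t).quasiMeasurePreserving.ae
      hg.ae_continuousAt] with x hx
    refine ContinuousAt.const_smul ?_ _
    exact ContinuousAt.comp (f := fun s : ℝ => s - x) hx (by fun_prop)

lemma IsCausal.rlIntegral_eq_zero (hg : IsCausal a g) (β : ℝ) {t : ℝ} (ht : t ≤ a) :
    rlIntegral β g t = 0 := by
  refine integral_eq_zero_of_ae (Eventually.of_forall fun x => ?_)
  rcases le_or_gt x 0 with h | h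
  · simp [rlKernel_of_nonpos _ h]
  · simp [hg.eq_zero (t - x) (by linarith)]

lemma IsCausal.rlIntegral (hg : IsCausal a g) {β : ℝ} (hβ : 0 < β) :
    IsCausal a (rlIntegral β g) :=
  .of_continuous (hg.continuous_rlIntegral hβ) fun _ => hg.rlIntegral_eq_zero β

lemma IsCausal.rlIntegral_add (hg : IsCausal a g) (hg' : IsCausal a g') {β : ℝ} (hβ : 0 < β)
    (t : ℝ) : _root_.rlIntegral β (fun s => g s + g' s) t =
      _root_.rlIntegral β g t + _root_.rlIntegral β g' t := by
  simp only [_root_.rlIntegral, smul_add]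
  exact integral_add (hg.integrable hβ t) (hg'.integrable hβ t)

lemma rlIntegral_const_mul (β : ℝ) (c : 𝕜) (g : ℝ → 𝕜) (t : ℝ) :
    rlIntegral β (fun s => c * g s) t = c * rlIntegral β g t := by
  simp only [rlIntegral, ← mul_smul_comm]
  exact integral_const_mul c _

lemma rlIntegral_comp_sub (β : ℝ) (g : ℝ → 𝕜) (c t : ℝ) :
    rlIntegral β (fun s => g (s - c)) t = rlIntegral β g (t - c) := by
  simp only [rlIntegral, sub_right_comm]

/-- The semigroup property of the Riemann–Liouville integrals. -/
theorem IsCausal.rlIntegral_rlIntegral (hg : IsCausal a g) {b c : ℝ} (hb : 0 < b) (hc : 0 < c)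
    (t : ℝ) : _root_.rlIntegral b (_root_.rlIntegral c g) t = _root_.rlIntegral (b + c) g t := by
  have h := convolution_assoc (μ := volume) (ν := volume) (f := rlKernel b) (g := rlKernel c)
    (k := g) (ContinuousLinearMap.mul ℝ ℝ)
    (ContinuousLinearMap.lsmul ℝ ℝ) (ContinuousLinearMap.lsmul ℝ ℝ)
    (ContinuousLinearMap.lsmul ℝ ℝ) (x₀ := t) (fun x y z => mul_smul x y z)
    (measurable_rlKernel b).aestronglyMeasurable (measurable_rlKernel c).aestronglyMeasurable
    hg.measurable.aestronglyMeasurable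
    (Eventually.of_forall fun z => integrable_rlKernel_mul_rlKernel hb hc z)
    (Eventually.of_forall fun z => ?_) ?_
  · have e : (convolution (rlKernel b) (rlKernel c) (ContinuousLinearMap.mul ℝ ℝ) volume) =
        rlKernel (b + c) := by
      ext z
      exact integral_rlKernel_mul_rlKernel hb hc z
    rw [e] at h
    exact h.symm
  · have := hg.norm.integrable hc z
    simp only [ConvolutionExistsAt, ContinuousLinearMap.mul_apply',
      Real.norm_of_nonneg (rlKernel_nonneg hc _)]
    exact this
  · have := (hg.norm.rlIntegral hc).integrable hb t
    simp only [ConvolutionExistsAt, ContinuousLinearMap.mul_apply', convolution,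
      Real.norm_of_nonneg (rlKernel_nonneg hc _), Real.norm_of_nonneg (rlKernel_nonneg hb _)]
    exact this

end Admissible

/-! ### The solution of the delay equation -/

lemma rlKernel_of_nonneg {β : ℝ} (hβ : 1 < β) {x : ℝ} (hx : 0 ≤ x) :
    rlKernel β x = x ^ (β - 1) / Real.Gamma β := by
  rcases hx.eq_or_lt with rfl | hx
  · rw [rlKernel_of_nonpos _ le_rfl, Real.zero_rpow (by linarith), zero_div]
  · exact rlKernel_of_pos β hx

lemma continuous_rlKernel {β : ℝ} (hβ : 1 < β) : Continuous (rlKernel β) := by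
  have : rlKernel β = fun x => (max x 0) ^ (β - 1) / Real.Gamma β := by
    ext x
    rcases le_total x 0 with hx | hx
    · rw [rlKernel_of_nonpos _ hx, max_eq_right hx, Real.zero_rpow (by linarith), zero_div]
    · rw [rlKernel_of_nonneg hβ hx, max_eq_left hx]
  rw [this]
  exact ((continuous_id.max continuous_const).rpow_const fun _ => Or.inr (by linarith)).div_const _

section Solution

variable {𝕜 : Type*} [RCLike 𝕜]

lemma IsCausal.indicator {a : ℝ} {F : ℝ → 𝕜} (hF : Continuous F) {S : Set ℝ}
    (hS : MeasurableSet S) (hfr : frontier S ⊆ {0}) (h0 : ∀ s ≤ a, S.indicator F s = 0) :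
    IsCausal a (S.indicator F) where
  measurable := hF.measurable.indicator hS
  ae_continuousAt := by
    have : ∀ᵐ x : ℝ, x ≠ 0 := by simp [ae_iff]
    filter_upwards [this] with x hx
    have hx' : x ∉ frontier S := fun h => hx (hfr h)
    by_cases hxS : x ∈ S
    · have : x ∈ interior S := by
        by_contra h
        exact hx' ⟨subset_closure hxS, h⟩
      refine hF.continuousAt.congr ?_
      filter_upwards [mem_interior_iff_mem_nhds.1 this] with y hy
      rw [indicator_of_mem hy]
    · have : x ∈ interior Sᶜ := by
        by_contra h
        rw [← frontier_compl] at hx'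
        exact hx' ⟨subset_closure hxS, h⟩
      refine continuousAt_const (y := (0 : 𝕜)) |>.congr ?_
      filter_upwards [mem_interior_iff_mem_nhds.1 this] with y hy
      rw [indicator_of_notMem hy]
  eq_zero := h0
  bounded T := by
    obtain ⟨M, hM⟩ := (isCompact_Icc (a := a) (b := T)).exists_bound_of_continuousOn hF.continuousOn
    refine ⟨max M 0, fun s hs => ?_⟩
    rcases le_total s a with h | h
    · rw [h0 s h, norm_zero]; exact le_max_right _ _
    · exact (norm_indicator_le_norm_self F s).trans ((hM s ⟨h, hs⟩).trans (le_max_left _ _))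

/-- The Grünwald–Letnikov derivative of order `α` of the affine history `(s + τ) c` on `(-τ, 0)`,
extended by zero. -/
noncomputable def historyForcing (α τ : ℝ) (c : 𝕜) : ℝ → 𝕜 :=
  (Iio 0).indicator fun s => rlKernel (2 - α) (s + τ) • c

/-- The total forcing term: the history term on `(-∞, 0)` and `f` on `[0, ∞)`. -/
noncomputable def totalForcing (α τ : ℝ) (c : 𝕜) (f : ℝ → 𝕜) (s : ℝ) : 𝕜 :=
  historyForcing α τ c s + (Ici 0).indicator f s

/-- Partial sums of the series solution. -/
noncomputable def partialSolution (α τ : ℝ) (l c : 𝕜) (f : ℝ → 𝕜) (N : ℕ) (t : ℝ) : 𝕜 :=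
  ∑ k ∈ Finset.range N, l ^ k * rlIntegral (α * (k + 1)) (totalForcing α τ c f) (t - k * τ)

/-- The series solution. -/
noncomputable def seriesSolution (α τ : ℝ) (l c : 𝕜) (f : ℝ → 𝕜) (t : ℝ) : 𝕜 :=
  partialSolution α τ l c f (⌈t / τ⌉₊ + 1) t

variable {α τ : ℝ} {l c : 𝕜} {f : ℝ → 𝕜}

lemma isCausal_historyForcing (h1 : α < 1) (hτ : 0 < τ) (c : 𝕜) :
    IsCausal (-τ) (historyForcing α τ c) := by
  refine IsCausal.indicator ?_ measurableSet_Iio (by simp) fun s hs => ?_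
  · exact ((continuous_rlKernel (by linarith)).comp (by fun_prop)).smul continuous_const
  · rw [indicator_of_mem (mem_Iio.2 (by linarith)), rlKernel_of_nonpos _ (by linarith), zero_smul]

lemma isCausal_indicator_Ici (hτ : 0 < τ) (hf : ContinuousOn f (Ici 0)) :
    IsCausal (-τ) ((Ici 0).indicator f) := by
  have hF : Continuous fun s => f (max s 0) :=
    hf.comp_continuous (by fun_prop) fun s => le_max_right s 0
  have e : (Ici (0 : ℝ)).indicator f = (Ici 0).indicator fun s => f (max s 0) :=
    indicator_congr fun s hs => by rw [max_eq_left hs]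
  rw [e]
  refine IsCausal.indicator hF measurableSet_Ici (by simp) fun s hs => ?_
  exact indicator_of_notMem (by simp; linarith) _

lemma isCausal_totalForcing (h1 : α < 1) (hτ : 0 < τ) (hf : ContinuousOn f (Ici 0)) (c : 𝕜) :
    IsCausal (-τ) (totalForcing α τ c f) :=
  (isCausal_historyForcing h1 hτ c).add (isCausal_indicator_Ici hτ hf)

lemma isCausal_partialSolution_term (h0 : 0 < α) (h1 : α < 1) (hτ : 0 < τ)
    (hf : ContinuousOn f (Ici 0)) (l c : 𝕜) (k : ℕ) :
    IsCausal (-τ) fun t =>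
      l ^ k * rlIntegral (α * (k + 1)) (totalForcing α τ c f) (t - k * τ) := by
  have hg := (isCausal_totalForcing h1 hτ hf c).rlIntegral (β := α * (k + 1)) (by positivity)
  have hc := (isCausal_totalForcing h1 hτ hf c).continuous_rlIntegral (β := α * (k + 1))
    (by positivity)
  refine .of_continuous (continuous_const.mul (hc.comp (by fun_prop))) fun s hs => ?_
  have : 0 ≤ k * τ := by positivity
  rw [hg.eq_zero _ (by linarith), mul_zero]

lemma isCausal_partialSolution (h0 : 0 < α) (h1 : α < 1) (hτ : 0 < τ)
    (hf : ContinuousOn f (Ici 0)) (l c : 𝕜) (N : ℕ) :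
    IsCausal (-τ) (partialSolution α τ l c f N) := by
  induction N with
  | zero =>
    have : partialSolution α τ l c f 0 = fun _ => 0 := by ext t; simp [partialSolution]
    rw [this]
    exact .of_continuous continuous_const fun _ _ => rfl
  | succ N ih =>
    have : partialSolution α τ l c f (N + 1) = fun t => partialSolution α τ l c f N t +
        l ^ N * rlIntegral (α * (N + 1)) (totalForcing α τ c f) (t - N * τ) := by
      ext t; exact Finset.sum_range_succ _ _
    rw [this]
    exact ih.add (isCausal_partialSolution_term h0 h1 hτ hf l c N)

lemma continuous_partialSolution (h0 : 0 < α) (h1 : α < 1) (hτ : 0 < τ)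
    (hf : ContinuousOn f (Ici 0)) (l c : 𝕜) (N : ℕ) :
    Continuous (partialSolution α τ l c f N) := by
  refine continuous_finsetSum _ fun k _ => continuous_const.mul ?_
  exact ((isCausal_totalForcing h1 hτ hf c).continuous_rlIntegral (by positivity)).comp
    (continuous_sub_right _)

/-- Integration commutes with the delay, and the semigroup law raises each order by `α`. -/
lemma rlIntegral_partialSolution (h0 : 0 < α) (h1 : α < 1) (hτ : 0 < τ)
    (hf : ContinuousOn f (Ici 0)) (l c : 𝕜) (N : ℕ) (t : ℝ) :
    rlIntegral α (partialSolution α τ l c f N) t = ∑ k ∈ Finset.range N,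
      l ^ k * rlIntegral (α * (k + 1 + 1)) (totalForcing α τ c f) (t - k * τ) := by
  induction N with
  | zero => simp [partialSolution, rlIntegral]
  | succ N ih =>
    have : partialSolution α τ l c f (N + 1) = fun t => partialSolution α τ l c f N t +
        l ^ N * rlIntegral (α * (N + 1)) (totalForcing α τ c f) (t - N * τ) := by
      ext t; exact Finset.sum_range_succ _ _
    rw [this, (isCausal_partialSolution h0 h1 hτ hf l c N).rlIntegral_add
      (isCausal_partialSolution_term h0 h1 hτ hf l c N) h0, ih, Finset.sum_range_succ,
      rlIntegral_const_mul, rlIntegral_comp_sub,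
      (isCausal_totalForcing h1 hτ hf c).rlIntegral_rlIntegral h0 (by positivity)]
    congr 4
    ring

/-- The partial sums are obtained by Picard iteration. -/
lemma partialSolution_succ (h0 : 0 < α) (h1 : α < 1) (hτ : 0 < τ)
    (hf : ContinuousOn f (Ici 0)) (l c : 𝕜) (N : ℕ) :
    partialSolution α τ l c f (N + 1) = rlIntegral α fun s =>
      totalForcing α τ c f s + l * partialSolution α τ l c f N (s - τ) := by
  ext t
  have hg : IsCausal (-τ) fun s => l * partialSolution α τ l c f N (s - τ) :=
    .of_continuous (continuous_const.mul
      ((continuous_partialSolution h0 h1 hτ hf l c N).comp (by fun_prop))) fun s hs => by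
        rw [(isCausal_partialSolution h0 h1 hτ hf l c N).eq_zero _ (by linarith), mul_zero]
  rw [(isCausal_totalForcing h1 hτ hf c).rlIntegral_add hg h0, rlIntegral_const_mul,
    rlIntegral_comp_sub, rlIntegral_partialSolution h0 h1 hτ hf, partialSolution,
    Finset.sum_range_succ', Finset.mul_sum, add_comm]
  congr 1
  · simp
  · refine Finset.sum_congr rfl fun k _ => ?_
    push_cast
    rw [pow_succ', mul_assoc, show t - ((k : ℝ) + 1) * τ = t - τ - k * τ by ring]

lemma partialSolution_eq_of_le (h1 : α < 1) (hτ : 0 < τ) (hf : ContinuousOn f (Ici 0)) {t : ℝ}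
    {N M : ℕ} (hN : t + τ ≤ N * τ) (hNM : N ≤ M) :
    partialSolution α τ l c f M t = partialSolution α τ l c f N t := by
  refine (Finset.sum_subset (Finset.range_mono hNM) fun k _ hk => ?_).symm
  have hk' : (N : ℝ) ≤ k := by
    have : N ≤ k := by simpa using hk
    exact_mod_cast this
  rw [(isCausal_totalForcing h1 hτ hf c).rlIntegral_eq_zero _ (by nlinarith), mul_zero]

lemma seriesSolution_eq (h1 : α < 1) (hτ : 0 < τ) (hf : ContinuousOn f (Ici 0)) {t : ℝ}
    {N : ℕ} (hN : t + τ ≤ N * τ) :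
    seriesSolution α τ l c f t = partialSolution α τ l c f N t := by
  -- Terms with `k τ ≥ t + τ` vanish; the extra `+ 1` accounts for the history of length `τ`.
  have h : t + τ ≤ (⌈t / τ⌉₊ + 1 : ℕ) * τ := by
    have := Nat.le_ceil (t / τ)
    rw [div_le_iff₀ hτ] at this
    push_cast
    linarith
  rw [seriesSolution]
  rcases le_total N (⌈t / τ⌉₊ + 1) with hle | hle
  · exact partialSolution_eq_of_le h1 hτ hf hN hle
  · exact (partialSolution_eq_of_le h1 hτ hf h hle).symm

lemma continuous_seriesSolution (h0 : 0 < α) (h1 : α < 1) (hτ : 0 < τ)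
    (hf : ContinuousOn f (Ici 0)) : Continuous (seriesSolution α τ l c f) := by
  rw [continuous_iff_continuousAt]
  intro t
  obtain ⟨N, hN⟩ := exists_nat_ge ((t + 1 + τ) / τ)
  rw [div_le_iff₀ hτ] at hN
  refine (continuous_partialSolution h0 h1 hτ hf l c N).continuousAt.congr ?_
  filter_upwards [Iio_mem_nhds (lt_add_one t)] with s hs
  exact (seriesSolution_eq h1 hτ hf (by linarith [mem_Iio.1 hs])).symm

/-- The integral of the history term to the left of the origin. -/
lemma rlIntegral_historyForcing_of_nonpos (h1 : α < 1) {β : ℝ} (hβ : 0 < β) {s : ℝ}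
    (hs : s ≤ 0) :
    rlIntegral β (historyForcing α τ c) s = rlKernel (β + (2 - α)) (s + τ) • c := by
  have e : (fun x => rlKernel β x • historyForcing α τ c (s - x)) =
      fun x => (rlKernel β x * rlKernel (2 - α) (s + τ - x)) • c := by
    ext x
    rcases le_or_gt x 0 with hx | hx
    · simp [rlKernel_of_nonpos _ hx]
    -- For `s ≤ 0 < x` the point `s - x` is negative, so the cut-off at the origin is invisible and
    -- the full kernel convolution remains.
    · rw [historyForcing, indicator_of_mem (mem_Iio.2 (by linarith)), smul_smul]
      congr 3
      ring
  rw [rlIntegral, e, integral_smul_const, integral_rlKernel_mul_rlKernel hβ (by linarith)]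

/-- The integral of the history term to the right of the origin. -/
lemma rlIntegral_historyForcing_of_nonneg (h1 : α < 1) (hτ : 0 < τ) {β : ℝ} (hβ : 0 < β) {s : ℝ}
    (hs : 0 ≤ s) :
    rlIntegral β (historyForcing α τ c) s =
      ((s + τ) ^ (β + 1 - α) / Real.Gamma (β + 2 - α) *
        incompleteBeta (τ / (s + τ)) (2 - α) β) • c := by
  have h2 : 0 < 2 - α := by linarith
  set z := s + τ with hz
  have hz0 : 0 < z := by linarith
  have hx0 : 0 < τ / z := by positivity
  have hx1 : τ / z ≤ 1 := by rw [div_le_one hz0]; linarith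
  -- The substitution `w = z - x` turns the cut-off `s - x < 0` into `w < τ`; scaling by `z` then
  -- makes it `r < τ / z`, the argument of the incomplete beta function.
  have e1 : rlIntegral β (historyForcing α τ c) s =
      (∫ w, (Iio τ).indicator (fun w => rlKernel (2 - α) w * rlKernel β (z - w)) w) • c := by
    rw [rlIntegral, ← integral_smul_const,
      ← integral_sub_left_eq_self (fun x => rlKernel β x • historyForcing α τ c (s - x)) volume z]
    refine integral_congr_ae (Eventually.of_forall fun w => ?_)
    have hsw : s - (z - w) = w - τ := by rw [hz]; ring
    simp only [hsw, historyForcing]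
    by_cases hw : w < τ
    · rw [indicator_of_mem (mem_Iio.2 (by linarith)), indicator_of_mem (mem_Iio.2 hw),
        sub_add_cancel, smul_smul, mul_comm]
    · rw [indicator_of_notMem (by simpa using hw), indicator_of_notMem (by simpa using hw)]
      simp
  have e2 := Measure.integral_comp_mul_left
    (fun w => (Iio τ).indicator (fun w => rlKernel (2 - α) w * rlKernel β (z - w)) w) z
  rw [abs_of_pos (inv_pos.2 hz0), smul_eq_mul, eq_inv_mul_iff_mul_eq₀ hz0.ne'] at e2
  have e3 : (fun r => (Iio τ).indicator (fun w => rlKernel (2 - α) w * rlKernel β (z - w)) (z * r)) =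
      fun r => z ^ (2 - α - 1) * z ^ (β - 1) * (Real.Gamma (2 - α) * Real.Gamma β)⁻¹ *
        (Ioo 0 (τ / z)).indicator (fun r => r ^ (2 - α - 1) * (1 - r) ^ (β - 1)) r := by
    ext r
    have hk := congrFun (rlKernel_mul_rlKernel_one_sub (2 - α) β) r
    by_cases hr : r < τ / z
    · have hr' : z * r < τ := by rwa [lt_div_iff₀ hz0, mul_comm] at hr
      rw [indicator_of_mem (mem_Iio.2 hr'), rlKernel_mul _ hz0,
        show z - z * r = z * (1 - r) by ring, rlKernel_mul _ hz0, mul_mul_mul_comm, hk]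
      by_cases hr0 : 0 < r
      · rw [indicator_of_mem (show r ∈ Ioo 0 1 from ⟨hr0, by linarith⟩),
          indicator_of_mem (show r ∈ Ioo 0 (τ / z) from ⟨hr0, hr⟩)]
        ring
      · rw [indicator_of_notMem fun h => hr0 h.1, indicator_of_notMem fun h => hr0 h.1]
        ring
    · have hr' : ¬ z * r < τ := by rwa [lt_div_iff₀ hz0, mul_comm] at hr
      rw [indicator_of_notMem (show z * r ∉ Iio τ from hr'), indicator_of_notMem fun h => hr h.2,
        mul_zero]
  rw [e1, ← e2, e3, integral_const_mul, integral_indicator measurableSet_Ioo, incompleteBeta,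
    intervalIntegral.integral_of_le hx0.le, integral_Ioc_eq_integral_Ioo, ProbabilityTheory.beta,
    show β + 1 - α = 1 + (2 - α - 1) + (β - 1) by ring, Real.rpow_add hz0, Real.rpow_add hz0,
    Real.rpow_one, show 2 - α + β = β + 2 - α by ring]
  congr 1
  have g1 := Real.Gamma_pos_of_pos h2
  have g2 := Real.Gamma_pos_of_pos hβ
  have g3 := Real.Gamma_pos_of_pos (show 0 < β + 2 - α by linarith)
  field_simp

lemma rlIntegral_indicator_Ici {β : ℝ} (f : ℝ → 𝕜) {s : ℝ} (hs : 0 ≤ s) :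
    rlIntegral β ((Ici 0).indicator f) s =
      1 / ((Real.Gamma β : ℝ) : 𝕜) * ∫ r in (0 : ℝ)..s, ((s - r) ^ (β - 1) : ℝ) • f r := by
  rw [rlIntegral, ← integral_sub_left_eq_self
    (fun x => rlKernel β x • (Ici (0 : ℝ)).indicator f (s - x)) volume s,
    intervalIntegral.integral_of_le hs, integral_Ioc_eq_integral_Ioo,
    ← integral_Ico_eq_integral_Ioo, ← integral_indicator measurableSet_Ico,
    ← integral_const_mul]
  refine integral_congr_ae (Eventually.of_forall fun r => ?_)
  simp only [sub_sub_cancel]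
  by_cases hr : r ∈ Ico 0 s
  · rw [indicator_of_mem hr, indicator_of_mem (mem_Ici.2 hr.1), rlKernel_of_pos _ (sub_pos.2 hr.2),
      RCLike.real_smul_eq_coe_mul, RCLike.real_smul_eq_coe_mul]
    push_cast
    ring
  · rw [indicator_of_notMem hr, mul_zero]
    by_cases hr0 : 0 ≤ r
    · have : s ≤ r := by
        by_contra h
        exact hr ⟨hr0, not_le.1 h⟩
      rw [rlKernel_of_nonpos _ (by linarith), zero_smul]
    · rw [indicator_of_notMem (by simpa using hr0), smul_zero]

lemma rlIntegral_indicator_Ici_of_nonpos {β : ℝ} (f : ℝ → 𝕜) {s : ℝ} (hs : s ≤ 0) :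
    rlIntegral β ((Ici 0).indicator f) s = 0 := by
  refine integral_eq_zero_of_ae (Eventually.of_forall fun x => ?_)
  rcases le_or_gt x 0 with hx | hx
  · simp [rlKernel_of_nonpos _ hx]
  · have : s - x ∉ Ici (0 : ℝ) := by simp; linarith
    simp only [indicator_of_notMem this, smul_zero, Pi.zero_apply]

lemma rlIntegral_totalForcing (h1 : α < 1) (hτ : 0 < τ) (hf : ContinuousOn f (Ici 0)) {β : ℝ}
    (hβ : 0 < β) (s : ℝ) :
    rlIntegral β (totalForcing α τ c f) s =
      rlIntegral β (historyForcing α τ c) s + rlIntegral β ((Ici 0).indicator f) s :=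
  (isCausal_historyForcing h1 hτ c).rlIntegral_add (isCausal_indicator_Ici hτ hf) hβ s

/-- Only the term `k = 0` is left, and the orders `α` and `2 - α` add up to `2`, whose kernel is `x`
on the positive axis. -/
lemma seriesSolution_of_nonpos (h0 : 0 < α) (h1 : α < 1) (hτ : 0 < τ)
    (hf : ContinuousOn f (Ici 0)) {t : ℝ} (ht : t ≤ 0) :
    seriesSolution α τ l c f t = (max (t + τ) 0) • c := by
  rw [seriesSolution_eq h1 hτ hf (N := 1) (by simpa using ht)]
  simp only [partialSolution, Finset.range_one, Finset.sum_singleton, pow_zero, one_mul,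
    Nat.cast_zero, zero_add, mul_one, zero_mul, sub_zero]
  rw [rlIntegral_totalForcing h1 hτ hf h0, rlIntegral_historyForcing_of_nonpos h1 h0 ht,
    rlIntegral_indicator_Ici_of_nonpos f ht, add_zero, show α + (2 - α) = 2 by ring]
  rcases le_total (t + τ) 0 with h | h
  · rw [rlKernel_of_nonpos _ h, max_eq_right h]
  · rw [rlKernel_of_nonneg one_lt_two h, max_eq_left h, Real.Gamma_two,
      show (2 : ℝ) - 1 = 1 by norm_num, Real.rpow_one, div_one]

/-- Backward differences with `h > 0` never look beyond `t`. -/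
lemma HasGLDerivAt.congr {u v : ℝ → 𝕜} {d : 𝕜} {t : ℝ} (hu : HasGLDerivAt α u d t)
    (h : ∀ s ≤ t, v s = u s) : HasGLDerivAt α v d t := by
  have e : ∀ᶠ x : ℝ in 𝓝[>] 0, ∀ j : ℕ, v (t - j * x) = u (t - j * x) := by
    filter_upwards [self_mem_nhdsWithin] with x hx j
    refine h _ (sub_le_self _ ?_)
    have := mem_Ioi.1 hx
    positivity
  refine ⟨?_, hu.2.congr' ?_⟩
  · filter_upwards [hu.1, e] with x hx he
    simpa only [he] using hx
  · filter_upwards [e] with x he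
    simp only [he]

/-- The series solves the delay equation. -/
theorem isModifiedFDDESolution_seriesSolution (h0 : 0 < α) (h1 : α < 1) (hτ : 0 < τ) (l y₀ : 𝕜)
    (hf : ContinuousOn f (Ici 0)) {φ : ℝ → 𝕜}
    (hφ : ∀ t ∈ Icc (-τ) 0, φ t = ((t / τ + 1 : ℝ) : 𝕜) * y₀) :
    IsModifiedFDDESolution α τ l φ f (seriesSolution α τ l (y₀ / (τ : 𝕜)) f) := by
  have hτ' : (τ : 𝕜) ≠ 0 := by exact_mod_cast hτ.ne'
  have hhist : ∀ t ∈ Icc (-τ) 0, seriesSolution α τ l (y₀ / (τ : 𝕜)) f t = φ t := by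
    intro t ht
    rw [seriesSolution_of_nonpos h0 h1 hτ hf ht.2, max_eq_left (by linarith [ht.1]), hφ t ht,
      RCLike.real_smul_eq_coe_mul]
    push_cast
    field_simp
  -- The affine history is zero at `-τ`, so its constant extension is the extension by zero, as
  -- causality demands.
  have hglue : ∀ s, glueHistory τ φ (seriesSolution α τ l (y₀ / (τ : 𝕜)) f) s =
      seriesSolution α τ l (y₀ / (τ : 𝕜)) f s := by
    intro s
    unfold glueHistory historyExt
    split_ifs with hs hs'
    · rw [seriesSolution_of_nonpos h0 h1 hτ hf hs, max_eq_right (by linarith),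
        hφ _ ⟨le_rfl, by linarith⟩, neg_div, div_self hτ.ne']
      simp
    · exact (hhist s ⟨not_lt.1 hs', hs⟩).symm
    · rfl
  refine ⟨(continuous_seriesSolution h0 h1 hτ hf).continuousOn, hhist, fun t ht => ?_⟩
  obtain ⟨N, hN⟩ := exists_nat_ge ((t + τ) / τ)
  rw [div_le_iff₀ hτ] at hN
  -- `N` is large enough for the partial sums to agree with the series up to time `t`, so `G` is the
  -- right-hand side there and `I^α G` is the next Picard iterate.
  set G : ℝ → 𝕜 := fun s => totalForcing α τ (y₀ / (τ : 𝕜)) f s +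
    l * partialSolution α τ l (y₀ / (τ : 𝕜)) f N (s - τ) with hG
  have hGc : IsCausal (-τ) G := (isCausal_totalForcing h1 hτ hf _).add <|
    .of_continuous (continuous_const.mul
      ((continuous_partialSolution h0 h1 hτ hf l _ N).comp (by fun_prop))) fun s hs => by
        rw [(isCausal_partialSolution h0 h1 hτ hf l _ N).eq_zero _ (by linarith), mul_zero]
  have hloc : ∀ s, 0 < s → totalForcing α τ (y₀ / (τ : 𝕜)) f s = f s := by
    intro s hs
    rw [totalForcing, historyForcing, indicator_of_notMem (by simpa using hs.le),
      indicator_of_mem (mem_Ici.2 hs.le), zero_add]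
  have hGt : ContinuousAt G t := by
    refine ContinuousAt.add ?_ (continuous_const.mul
      ((continuous_partialSolution h0 h1 hτ hf l _ N).comp (by fun_prop))).continuousAt
    refine (hf.continuousAt (Ici_mem_nhds ht)).congr ?_
    filter_upwards [Ioi_mem_nhds ht] with s hs
    exact (hloc s hs).symm
  obtain ⟨M, hM⟩ := hGc.bounded t
  have hD := hasGLDerivAt_rlIntegral h0 h1 hGc.measurable hGc.eq_zero hM hGt
  have hval : G t = l * seriesSolution α τ l (y₀ / (τ : 𝕜)) f (t - τ) + f t := by
    rw [hG, seriesSolution_eq h1 hτ hf (N := N) (by linarith)]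
    simp only [hloc t ht]
    ring
  rw [← hval]
  refine hD.congr fun s hs => ?_
  rw [hglue, ← partialSolution_succ h0 h1 hτ hf, seriesSolution_eq h1 hτ hf]
  push_cast
  linarith

/-- The closed form of the series solution. -/
theorem seriesSolution_eq_incompleteBeta (h0 : 0 < α) (h1 : α < 1) (hτ : 0 < τ) (l c : 𝕜)
    (hf : ContinuousOn f (Ici 0)) (p : ℕ) (t : ℝ) (ht : t ∈ Ico (p * τ) ((p + 1) * τ)) :
    seriesSolution α τ l c f t =
      c * (l ^ (p + 1) *
            (((t - p * τ) ^ (α * (p + 1) + 1) / Real.Gamma (α * (p + 1) + 2) : ℝ) : 𝕜) +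
          ∑ k ∈ Finset.range (p + 1), l ^ k *
              (((t + τ - k * τ) ^ (α * k + 1) / Real.Gamma (α * k + 2) *
                incompleteBeta (τ / (t + τ - k * τ)) (2 - α) ((k + 1) * α) : ℝ) : 𝕜)) +
        generalizedIntegral α τ l f t := by
  have ht0 : 0 ≤ t := le_trans (by positivity) ht.1
  have hfloor : ⌊t / τ⌋₊ = p := by
    rw [Nat.floor_eq_iff (by positivity), le_div_iff₀ hτ, div_lt_iff₀ hτ]
    exact ht
  -- In the term `k = p + 1` the shifted time lies in `[-τ, 0)`: `f` does not contribute and the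
  -- beta integral is complete, which leaves a pure power.
  have hlast : rlIntegral (α * ((p + 1 : ℕ) + 1)) (totalForcing α τ c f) (t - (p + 1 : ℕ) * τ) =
      (((t - p * τ) ^ (α * (p + 1) + 1) / Real.Gamma (α * (p + 1) + 2) : ℝ) : 𝕜) * c := by
    have hs : t - (p + 1 : ℕ) * τ ≤ 0 := by push_cast; linarith [ht.2]
    have hβ : 0 < α * ((p + 1 : ℕ) + 1) := by positivity
    have hpα : 0 < α * ((p : ℝ) + 1) := by positivity
    rw [rlIntegral_totalForcing h1 hτ hf hβ, rlIntegral_historyForcing_of_nonpos h1 hβ hs,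
      rlIntegral_indicator_Ici_of_nonpos f hs, add_zero, ← RCLike.real_smul_eq_coe_mul,
      show α * ((p + 1 : ℕ) + 1) + (2 - α) = α * (p + 1) + 2 by push_cast; ring,
      show t - (p + 1 : ℕ) * τ + τ = t - p * τ by push_cast; ring,
      rlKernel_of_nonneg (by linarith) (by linarith [ht.1]),
      show α * (p + 1) + 2 - 1 = α * ((p : ℝ) + 1) + 1 by ring]
  have hterm : ∀ k ∈ Finset.range (p + 1),
      l ^ k * rlIntegral (α * (k + 1)) (totalForcing α τ c f) (t - k * τ) =
      c * (l ^ k * (((t + τ - k * τ) ^ (α * k + 1) / Real.Gamma (α * k + 2) *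
        incompleteBeta (τ / (t + τ - k * τ)) (2 - α) ((k + 1) * α) : ℝ) : 𝕜)) +
      l ^ k / ((Real.Gamma (α * k + α) : ℝ) : 𝕜) *
        ∫ r in (0 : ℝ)..(t - k * τ), ((t - k * τ - r) ^ (α * k + α - 1) : ℝ) • f r := by
    intro k hk
    have hk' : (k : ℝ) ≤ p := by
      have : k ≤ p := by have := Finset.mem_range.1 hk; omega
      exact_mod_cast this
    have hs : 0 ≤ t - k * τ := by
      have : (k : ℝ) * τ ≤ p * τ := by gcongr
      linarith [ht.1]
    have hβ : 0 < α * ((k : ℝ) + 1) := by positivity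
    rw [rlIntegral_totalForcing h1 hτ hf hβ, rlIntegral_historyForcing_of_nonneg h1 hτ hβ hs,
      rlIntegral_indicator_Ici f hs, RCLike.real_smul_eq_coe_mul,
      show t - k * τ + τ = t + τ - k * τ by ring,
      show α * ((k : ℝ) + 1) + 1 - α = α * k + 1 by ring,
      show α * ((k : ℝ) + 1) + 2 - α = α * k + 2 by ring,
      show ((k : ℝ) + 1) * α = α * (k + 1) by ring,
      show α * (k : ℝ) + α = α * (k + 1) by ring]
    ring
  rw [seriesSolution_eq h1 hτ hf (N := p + 1 + 1) (by push_cast; linarith [ht.2]), partialSolution,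
    Finset.sum_range_succ, hlast, Finset.sum_congr rfl hterm, Finset.sum_add_distrib,
    ← Finset.mul_sum, generalizedIntegral, hfloor]
  ring

end Solution

theorem mainTheorem6 {𝕜 : Type*} [RCLike 𝕜] (α τ : ℝ) (hα₀ : 0 < α) (hα₁ : α < 1) (hτ : 0 < τ)
    (l y₀ : 𝕜) (f : ℝ → 𝕜) (hf : ContinuousOn f (Ici 0)) (φ : ℝ → 𝕜)
    (hφ : ∀ t ∈ Icc (-τ) 0, φ t = ((t / τ + 1 : ℝ) : 𝕜) * y₀) :
    (∃ y : ℝ → 𝕜, IsModifiedFDDESolution α τ l φ f y) ∧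
    ∀ y : ℝ → 𝕜, IsModifiedFDDESolution α τ l φ f y →
      ∀ (p : ℕ) (t : ℝ), t ∈ Ico (p * τ) ((p + 1) * τ) →
        y t =
          y₀ / (τ : 𝕜) *
            (l ^ (p + 1) *
                (((t - p * τ) ^ (α * (p + 1) + 1) / Real.Gamma (α * (p + 1) + 2) : ℝ) : 𝕜) +
              ∑ k ∈ Finset.range (p + 1),
                l ^ k *
                  (((t + τ - k * τ) ^ (α * k + 1) / Real.Gamma (α * k + 2) *
                    incompleteBeta (τ / (t + τ - k * τ)) (2 - α) ((k + 1) * α) : ℝ) : 𝕜)) +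
            generalizedIntegral α τ l f t := by
  refine ⟨⟨_, isModifiedFDDESolution_seriesSolution hα₀ hα₁ hτ l y₀ hf hφ⟩, fun y hy p t ht => ?_⟩
  have hpτ : 0 ≤ p * τ := by positivity
  rw [hy.eqOn hα₀ hα₁ hτ (isModifiedFDDESolution_seriesSolution hα₀ hα₁ hτ l y₀ hf hφ)
    (mem_Ici.2 (by linarith [ht.1]))]
  exact seriesSolution_eq_incompleteBeta hα₀ hα₁ hτ l _ hf p t ht
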